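/- Let $d\in\mathbb N$, let $S$ be a finite set and $V=\mathbb Z^d\times S$. For each $\sigma\in S$ let $\pi_\sigma:\mathbb Z^d\to\mathbb R$ be the jump rates of a symmetric nearest-neighbour random walk: $\pi_\sigma(e_k)=\pi_\sigma(-e_k)>0$ for each standard basis vector $e_k$ and $\pi_\sigma(x)=0$ for every other $x$ (this includes the simple symmetric random walk with a speed that depends on $\sigma$). Let $c(\sigma,\sigma')\ge 0$ be symmetric and irreducible transition rates on $S$, and let $\alpha>0$. For rates $p(v,w)$ on $V$ and $n\in\mathbb N$, let $\Omega_n=\{\xi\in\mathbb N^V:\sum_v\xi_v=n\}$ and consider the Markov process of $n$ independent particles on $\Omega_n$ with generator $$\mathscr L f(\xi)=\sum_{v,w\in V}\alpha\,p(v,w)\,\xi_v\,\bigl(f(\xi^{v\to w})-f(\xi)\bigr),$$ where $\xi^{v\to w}$ is $\xi$ with one particle moved from $v$ to $w$. The process with rates $p$ is said to admit a successful coupling if for all $n\in\mathbb N$ and $\xi,\xi'\in\Omega_n$ there are, on one probability space, two (càdlàg) processes $\xi^{(1)}(t)$ and $\xi^{(2)}(t)$, $t\ge0$, with generator $\mathscr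 L$, started from $\xi$ and $\xi'$ respectively, such that $$\tau=\inf\{T>0:\ \xi^{(1)}(t)=\xi^{(2)}(t)\ \text{for all } t\ge T\}$$ is almost surely finite. Then the following hold. 1. (Multi-layer symmetric independent random walkers.) The process with rates $$p\big((x,\sigma),(y,\sigma')\big)=\pi_\sigma(y-x)\,\delta_{\sigma,\sigma'}+c(\sigma,\sigma')\,\delta_{x,y}$$ admits a successful coupling. 2. (Dual run-and-tumble particles with random walk jumps.) For every $v:S\to\mathbb Z^d$, $\kappa>0$ and $\lambda\ge 0$, the process with rates $$\widehat p\big((x,\sigma),(y,\sigma')\big)=\kappa\,\pi_\sigma(y-x)\,\delta_{\sigma,\sigma'}+\lambda\,\delta_{\sigma,\sigma'}\,\delta_{y,x-v(\sigma)}+c(\sigma,\sigma')\,\delta_{x,y}$$ admits a successful coupling. 3. (Dual run-and-tumble particles without random walk jumps.) If $\kappa=0$, $\lambda>0$ and the integer linear combinations of the vectors $v(\sigma)$, $\sigma\in S$, fill all of $\mathbb Z^d$, then the process with rates $\widehat p$ admits a successful coupling. -/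

import Mathlib

open Filter Topology MeasureTheory
open scoped NNReal ENNReal

universe u

noncomputable section

/-- The particle state space `V = ℤ^d × S`: a position together with an internal state (layer). -/
abbrev Site (d : ℕ) (S : Type u) : Type u := (Fin d → ℤ) × S

/-- `Ω_n`: the configurations `ξ ∈ ℕ^V` with exactly `n` particles. -/
def Config (V : Type u) (n : ℕ) : Type u := {ξ : V →₀ ℕ // ξ.degree = n}

/-- `ξ^{v → w}`: one particle has moved from `v` to `w`, if there is a particle at `v`. -/
def Config.move {V : Type u} {n : ℕ} (ξ : Config V n) (v w : V) : Config V n :=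
  if h : ξ.1 v ≠ 0 then
    ⟨ξ.1 - Finsupp.single v 1 + Finsupp.single w 1, by
      have h1 : Finsupp.single v 1 ≤ ξ.1 := by
        rw [Finsupp.single_le_iff]; omega
      have h2 : (ξ.1 - Finsupp.single v 1 + Finsupp.single v 1).degree = n := by
        rw [tsub_add_cancel_of_le h1]; exact ξ.2
      simpa using h2⟩
  else ξ

/-- The generator of independent particles with single-particle rates `p`, acting on functions of
configurations with `n` particles: `L f(ξ) = ∑_{v,w} p(v,w) ξ_v α (f(ξ^{v → w}) - f(ξ))`. -/
def indepGenerator {V : Type u} {n : ℕ} (α : ℝ) (p : V → V → ℝ)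
    (f : Config V n → ℝ) (ξ : Config V n) : ℝ :=
  ∑ v ∈ ξ.1.support, ∑' w, p v w * ((ξ.1 v : ℝ) * α) * (f (ξ.move v w) - f ξ)

/-- The rates of a symmetric nearest-neighbour random walk on `ℤ^d`: positive and symmetric in every
coordinate direction, zero otherwise. -/
structure IsSimpleSymmetric {d : ℕ} (π : (Fin d → ℤ) → ℝ) : Prop where
  pos : ∀ k, 0 < π (Pi.single k 1)
  symm : ∀ x, π (-x) = π x
  nearest : ∀ x, (∀ k, x ≠ Pi.single k 1 ∧ x ≠ -Pi.single k 1) → π x = 0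

/-- Symmetric and irreducible transition rates between internal states. -/
structure IsSymmIrreducible {S : Type u} (c : S → S → ℝ) : Prop where
  nonneg : ∀ σ σ', 0 ≤ c σ σ'
  symm : ∀ σ σ', c σ σ' = c σ' σ
  irreducible : ∀ σ σ', Relation.ReflTransGen (fun a b => 0 < c a b) σ σ'

/-- The rates of a multi-layer symmetric random walker:
`p((x,σ),(y,σ')) = π_σ(y-x) δ_{σ,σ'} + c(σ,σ') δ_{x,y}`. -/
def walkRate {d : ℕ} {S : Type u} [DecidableEq S] (π : S → (Fin d → ℤ) → ℝ) (c : S → S → ℝ)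
    (a b : Site d S) : ℝ :=
  (if a.2 = b.2 then π a.2 (b.1 - a.1) else 0) + (if a.1 = b.1 then c a.2 b.2 else 0)

/-- The rates of the time-reversed (dual) run-and-tumble particle:
`κ π_σ(y-x) δ_{σ,σ'} + λ δ_{σ,σ'} δ_{y,x-v(σ)} + c(σ,σ') δ_{x,y}`. -/
def dualRtpRate {d : ℕ} {S : Type u} [DecidableEq S] (κ lam : ℝ) (π : S → (Fin d → ℤ) → ℝ)
    (vel : S → (Fin d → ℤ)) (c : S → S → ℝ) (a b : Site d S) : ℝ :=
  (if a.2 = b.2 then κ * π a.2 (b.1 - a.1) else 0)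
    + (if a.2 = b.2 ∧ b.1 = a.1 - vel a.2 then lam else 0)
    + (if a.1 = b.1 then c a.2 b.2 else 0)

/-- `P` is the transition function of a Markov process on the countable set `E` with
generator `L`: it is a semigroup of probability kernels, and `(P_t f - f)/t → L f` pointwise as
`t ↓ 0`, for every bounded `f`. -/
structure IsTransitionFunction {E : Type u} (L : (E → ℝ) → E → ℝ) (P : ℝ≥0 → E → PMF E) :
    Prop where
  zero : ∀ x, P 0 x = PMF.pure x
  add : ∀ s t x, P (s + t) x = (P s x).bind (P t)
  generator : ∀ f : E → ℝ, (∃ C, ∀ y, |f y| ≤ C) → ∀ x,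
    Tendsto (fun t : ℝ≥0 => ((∑' y, (P t x y).toReal * f y) - f x) / (t : ℝ)) (𝓝[>] 0) (𝓝 (L f x))

/-- The information generated by the process up to time `s`. -/
abbrev pastSigma {Ω E : Type u} (X : ℝ≥0 → Ω → E) (s : ℝ≥0) : MeasurableSpace Ω :=
  ⨆ u ∈ Set.Iic s, MeasurableSpace.comap (X u) ⊤

/-- `X` is (a version with càdlàg paths, for the discrete topology of the countable set `E`, of) the
Markov process with generator `L` started from `x₀`. -/
structure IsMarkovProcessFrom {Ω E : Type u} [MeasurableSpace Ω] (μ : Measure Ω)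
    (L : (E → ℝ) → E → ℝ) (x₀ : E) (X : ℝ≥0 → Ω → E) : Prop where
  measurable : ∀ t x, MeasurableSet {ω | X t ω = x}
  initial : ∀ᵐ ω ∂μ, X 0 ω = x₀
  right_cts : ∀ᵐ ω ∂μ, ∀ t, ∀ᶠ s in 𝓝[>] t, X s ω = X t ω
  left_lim : ∀ᵐ ω ∂μ, ∀ t, ∃ x, ∀ᶠ s in 𝓝[<] t, X s ω = x
  markov : ∃ P, IsTransitionFunction L P ∧
    ∀ (s t : ℝ≥0) (A : Set Ω), MeasurableSet[pastSigma X s] A → ∀ x y,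
      μ (A ∩ {ω | X s ω = x} ∩ {ω | X (s + t) ω = y}) = μ (A ∩ {ω | X s ω = x}) * P t x y

/-- The coupling time `inf {T > 0 : X t = X' t for all t ≥ T}`, with values in `[0, ∞]`. -/
def couplingTime {Ω E : Type u} (X X' : ℝ≥0 → Ω → E) (ω : Ω) : ℝ≥0∞ :=
  sInf ((fun T : ℝ≥0 => (T : ℝ≥0∞)) '' {T | 0 < T ∧ ∀ t, T ≤ t → X t ω = X' t ω})

/-- For any two initial states there is a coupling of the two processes with generator `L` whose
coupling time is almost surely finite. -/
def HasSuccessfulCoupling {E : Type u} (L : (E → ℝ) → E → ℝ) : Prop :=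
  ∀ x x' : E, ∃ (Ω : Type u) (_ : MeasurableSpace Ω) (μ : Measure Ω) (X X' : ℝ≥0 → Ω → E),
    IsProbabilityMeasure μ ∧ IsMarkovProcessFrom μ L x X ∧ IsMarkovProcessFrom μ L x' X' ∧
      ∀ᵐ ω ∂μ, couplingTime X X' ω < ⊤

/-- Independent particles on `V` with single-particle rates `p` (and factor `α`) admit a successful
coupling: for each `n`, any two initial configurations with `n` particles can be coupled. -/
def IndepParticlesCouple {V : Type u} (α : ℝ) (p : V → V → ℝ) : Prop :=
  ∀ n : ℕ, HasSuccessfulCoupling (indepGenerator (n := n) α p)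

end

/-! The coupling does not act on positions. Each particle is lifted to a vector counting its jumps
of each kind, together with its layer; the kinds are the finitely many pairs of a layer and a jump
vector of positive rate available there. A site is the image of a lift (`project`), and every site
is such an image because the jump vectors generate the lattice. It is therefore enough to make lifts
meet.

Fix a labelling and treat the n pairs of particles separately. Each event (a jump of kind `j`, or a
change of layer) comes with a fair coin. The first particle reacts on heads; the second uses the
same coin if the two already agree in the relevant coordinate, and the opposite coin otherwise
(`pairStep`). Each particle alone then has the right rates. While the layers differ, only one
particle of the pair reacts to a change of layer, so irreducibility makes them meet, and from then
on they stay equal. In a common layer the difference of the jump counts of kind `j` is a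
time-changed simple symmetric walk on the integers absorbed at 0 (`natAbs_gap_pairsStep`). Its
absolute value is a nonnegative integer martingale, hence converges, hence is eventually constant,
which is possible only at 0 (`ae_exists_eq_zero`). Only recurrence in dimension one is used,
whatever `d` is, and the individual jumps may have a drift: that is why run-and-tumble particles are
covered.

That the relevant events keep occurring follows from a word argument: layers form a finite
automaton, one word serves all its states (`exists_universal_word`), and every word of positive
probability recurs in an i.i.d. sequence (`ae_exists_word`).

Total rates are bounded for fixed n, so continuous time is obtained by uniformization: an i.i.d.
sequence of exponential waiting times and letters drives a discrete chain.
`isMarkovProcessFrom_run_count` shows that a lumpable image of this chain is the Markov process with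
the prescribed generator; `hasSuccessfulCoupling_of_chain` applies this to the two marginals of one
chain. -/

noncomputable section

/-! ### Sequences of independent identically distributed variables -/

namespace IIDSeq

variable {X : Type*}

/-- The sequence with its first `m` terms dropped. -/
def shift (m : ℕ) (ω : ℕ → X) : ℕ → X := fun i => ω (m + i)

/-- The first `m` terms of one sequence, followed by another sequence. -/
def glue (m : ℕ) (p : (ℕ → X) × (ℕ → X)) : ℕ → X := fun i => if i < m then p.1 i else p.2 (i - m)

/-- A letter followed by a sequence. -/
def cons (x : X) (ω : ℕ → X) : ℕ → X
  | 0 => x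
  | i + 1 => ω i

@[simp] lemma cons_zero (x : X) (ω : ℕ → X) : cons x ω 0 = x := rfl

@[simp] lemma cons_succ (x : X) (ω : ℕ → X) (i : ℕ) : cons x ω (i + 1) = ω i := rfl

@[simp] lemma shift_glue (m : ℕ) (ω ω' : ℕ → X) : shift m (glue m (ω, ω')) = ω' := by
  funext i; simp [shift, glue]

lemma glue_of_lt {m i : ℕ} (h : i < m) (ω ω' : ℕ → X) : glue m (ω, ω') i = ω i := by
  simp [glue, h]

lemma glue_one (ω ω' : ℕ → X) : glue 1 (ω, ω') = cons (ω 0) ω' := by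
  funext i; cases i <;> simp [glue]

variable [MeasurableSpace X]

lemma measurable_shift (m : ℕ) : Measurable (shift m : (ℕ → X) → ℕ → X) :=
  measurable_pi_lambda _ fun i => measurable_pi_apply (m + i)

lemma measurable_glue (m : ℕ) : Measurable (glue m : (ℕ → X) × (ℕ → X) → ℕ → X) := by
  refine measurable_pi_lambda _ fun i => ?_
  by_cases h : i < m
  · simp only [glue, h, if_true]; fun_prop
  · simp only [glue, h, if_false]; fun_prop

lemma measurable_cons : Measurable (fun p : X × (ℕ → X) => cons p.1 p.2) := by
  refine measurable_pi_lambda _ fun i => ?_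
  cases i
  · exact measurable_fst
  · exact (measurable_pi_apply _).comp measurable_snd

variable (ν : Measure X) [IsProbabilityMeasure ν]

/-- The law of a sequence of independent variables with law `ν`. -/
abbrev law : Measure (ℕ → X) := Measure.infinitePi fun _ : ℕ => ν

/-- A cylinder pulls back to a rectangle, its indices below `m` constraining one sequence and the
others the second, so the product formula characterizing the infinite product measure holds. This is
the form in which the Markov property of the sequence is used later. -/
lemma measurePreserving_glue (m : ℕ) :
    MeasurePreserving (glue m) ((law ν).prod (law ν)) (law ν) := by
  refine ⟨measurable_glue m, Measure.eq_infinitePi _ fun s t ht => ?_⟩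
  rw [Measure.map_apply (measurable_glue m) (MeasurableSet.pi s.countable_toSet fun i _ => ht i)]
  have h : glue m ⁻¹' (Set.pi s t) =
      (Set.pi (s.filter (· < m) : Finset ℕ) t) ×ˢ
        (Set.pi ((s.filter (¬ · < m)).image (· - m) : Finset ℕ) fun i => t (i + m)) := by
    ext ⟨ω, ω'⟩
    simp only [Set.mem_preimage, Set.mem_pi, Finset.mem_coe, Set.mem_prod, Finset.mem_filter,
      Finset.mem_image, glue]
    constructor
    · intro h
      refine ⟨fun i hi => by simpa [hi.2] using h i hi.1, ?_⟩
      rintro _ ⟨i, hi, rfl⟩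
      have h2 := h i hi.1
      rw [if_neg hi.2] at h2
      rwa [Nat.sub_add_cancel (not_lt.1 hi.2)]
    · rintro ⟨h1, h2⟩ i hi
      split_ifs with him
      · exact h1 i ⟨hi, him⟩
      · have h3 := h2 (i - m) ⟨i, ⟨hi, him⟩, rfl⟩
        rwa [Nat.sub_add_cancel (not_lt.1 him)] at h3
  rw [h, Measure.prod_prod, Measure.infinitePi_pi _ fun i _ => ht i,
    Measure.infinitePi_pi _ fun i _ => ht (i + m),
    ← Finset.prod_filter_mul_prod_filter_not s (· < m)]
  congr 1
  rw [Finset.prod_image]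
  · refine Finset.prod_congr rfl fun i hi => ?_
    rw [Nat.sub_add_cancel (not_lt.1 (Finset.mem_filter.1 hi).2)]
  · intro a ha b hb hab
    have ha' := (Finset.mem_filter.1 (Finset.mem_coe.1 ha)).2
    have hb' := (Finset.mem_filter.1 (Finset.mem_coe.1 hb)).2
    simp only at hab
    omega

lemma measurePreserving_shift (m : ℕ) : MeasurePreserving (shift m) (law ν) (law ν) := by
  refine ⟨measurable_shift m, ?_⟩
  conv_lhs => rw [← (measurePreserving_glue ν m).map_eq]
  rw [Measure.map_map (measurable_shift m) (measurable_glue m)]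
  have : (shift m ∘ glue m : (ℕ → X) × (ℕ → X) → ℕ → X) = Prod.snd := by
    funext ⟨ω, ω'⟩; simp
  rw [this, Measure.map_snd_prod]; simp

lemma lintegral_law_eq_glue (m : ℕ) {f : (ℕ → X) → ℝ≥0∞} (hf : Measurable f) :
    ∫⁻ ω, f ω ∂law ν = ∫⁻ ω, ∫⁻ ω', f (glue m (ω, ω')) ∂law ν ∂law ν := by
  rw [← (measurePreserving_glue ν m).lintegral_comp hf, lintegral_prod]
  exact (hf.comp (measurable_glue m)).aemeasurable

lemma lintegral_law_eq_cons {f : (ℕ → X) → ℝ≥0∞} (hf : Measurable f) :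
    ∫⁻ ω, f ω ∂law ν = ∫⁻ x, ∫⁻ ω', f (cons x ω') ∂law ν ∂ν := by
  rw [lintegral_law_eq_glue ν 1 hf]
  simp only [glue_one]
  rw [← (measurePreserving_eval_infinitePi (fun _ : ℕ => ν) 0).lintegral_comp
    (f := fun x => ∫⁻ ω', f (cons x ω') ∂law ν)]
  exact Measurable.lintegral_prod_right' (f := fun p : X × (ℕ → X) => f (cons p.1 p.2))
    (hf.comp measurable_cons)

lemma law_apply_eq_cons {B : Set (ℕ → X)} (hB : MeasurableSet B) :
    law ν B = ∫⁻ x, law ν {ω' | cons x ω' ∈ B} ∂ν := by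
  rw [← lintegral_indicator_one hB, lintegral_law_eq_cons ν (measurable_one.indicator hB)]
  refine lintegral_congr fun x => ?_
  have h : MeasurableSet {ω' | cons x ω' ∈ B} :=
    (measurable_cons.comp measurable_prodMk_left : Measurable fun ω' => cons x ω') hB
  rw [← lintegral_indicator_one h]
  rfl

lemma law_inter_shift (m : ℕ) {E B : Set (ℕ → X)} (hE : MeasurableSet E) (hB : MeasurableSet B)
    (hEm : ∀ ω ω', (∀ i < m, ω i = ω' i) → (ω ∈ E ↔ ω' ∈ E)) :
    law ν (E ∩ shift m ⁻¹' B) = law ν E * law ν B := by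
  have hS := measurable_shift (X := X) m hB
  rw [← (measurePreserving_glue ν m).measure_preimage (hE.inter hS).nullMeasurableSet,
    ← Measure.prod_prod]
  congr 1
  ext ⟨ω, ω'⟩
  simp only [Set.mem_preimage, Set.mem_inter_iff, shift_glue, Set.mem_prod]
  rw [hEm (glue m (ω, ω')) ω fun i hi => glue_of_lt hi ω ω']

/-- If the word never occurs, then it fails in the first block of length `m` and never occurs after
that block. These two events are independent, so the probability `b` of never satisfies `b ≤ (1 - ε)
b` with `ε > 0`, and `b = 0`. -/
lemma ae_exists_word {D : ℕ → Set X} (hD : ∀ i, MeasurableSet (D i)) (m : ℕ)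
    (hpos : ∀ i < m, ν (D i) ≠ 0) : ∀ᵐ ω ∂law ν, ∃ p, ∀ i < m, ω (p + i) ∈ D i := by
  set E : Set (ℕ → X) := Set.pi (Finset.range m) D with hEdef
  have hE : MeasurableSet E := MeasurableSet.pi (Finset.countable_toSet _) fun i _ => hD i
  set B : Set (ℕ → X) := {ω | ¬ ∃ p, ∀ i < m, ω (p + i) ∈ D i} with hBdef
  have hBm : MeasurableSet B := by
    have : B = ⋂ p, (shift p ⁻¹' E)ᶜ := by
      ext ω; simp [hBdef, hEdef, shift]
    rw [this]
    exact MeasurableSet.iInter fun p => (measurable_shift p hE).compl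
  have hEpos : law ν E ≠ 0 := by
    rw [hEdef, Measure.infinitePi_pi _ fun i _ => hD i]
    exact Finset.prod_ne_zero_iff.2 fun i hi => hpos i (Finset.mem_range.1 hi)
  have hsub : B ⊆ Eᶜ ∩ shift m ⁻¹' B := by
    intro ω hω
    refine ⟨fun h => hω ⟨0, fun i hi => by simpa using h i (by simpa using hi)⟩, ?_⟩
    rintro ⟨p, hp⟩
    exact hω ⟨m + p, fun i hi => by simpa [shift, add_assoc] using hp i hi⟩
  have hle : law ν B ≤ law ν Eᶜ * law ν B := by
    refine (measure_mono hsub).trans_eq (law_inter_shift ν m hE.compl hBm fun ω ω' h => ?_)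
    simp only [hEdef, Set.mem_compl_iff, Set.mem_pi, Finset.mem_coe, Finset.mem_range]
    exact not_congr (forall₂_congr fun i hi => by rw [h i hi])
  change law ν B = 0
  by_contra h0
  have hlt : law ν Eᶜ < 1 := by
    rw [prob_compl_eq_one_sub hE]
    exact ENNReal.sub_lt_self ENNReal.one_ne_top one_ne_zero hEpos
  have := ENNReal.mul_lt_mul_left h0 (measure_ne_top (law ν) B) hlt
  rw [one_mul] at this
  exact absurd hle (not_le.2 this)

/-- A property that holds almost surely holds almost surely for all the shifted sequences. -/
lemma ae_forall_shift {p : (ℕ → X) → Prop} (h : ∀ᵐ ω ∂law ν, p ω) :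
    ∀ᵐ ω ∂law ν, ∀ m, p (shift m ω) :=
  ae_all_iff.2 fun m => (measurePreserving_shift ν m).quasiMeasurePreserving.ae h

end IIDSeq

/-! ### The exponential clock -/

namespace ExpClock

open ProbabilityTheory

lemma lintegral_expMeasure (R : ℝ) {f : ℝ → ℝ≥0∞} (hf : Measurable f) :
    ∫⁻ x, f x ∂expMeasure R = ∫⁻ x in Set.Ioi 0, ENNReal.ofReal (R * Real.exp (-(R * x))) * f x := by
  have h : expMeasure R = volume.withDensity (exponentialPDF R) := rfl
  have hm : Measurable (exponentialPDF R) := (measurable_exponentialPDFReal R).ennreal_ofReal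
  rw [h, lintegral_withDensity_eq_lintegral_mul _ hm hf,
    ← lintegral_indicator measurableSet_Ioi]
  refine lintegral_congr_ae ?_
  filter_upwards [show ∀ᵐ x : ℝ, x ≠ 0 by simp [ae_iff]] with x hx
  rcases lt_or_gt_of_ne hx with hx | hx
  · simp [exponentialPDF_of_neg hx, not_lt.2 hx.le]
  · rw [Set.indicator_of_mem (Set.mem_Ioi.2 hx), Pi.mul_apply, exponentialPDF_of_nonneg hx.le]

/-- The exponential distribution has no memory. -/
lemma lintegral_expMeasure_sub (R : ℝ) {a : ℝ} (ha : 0 ≤ a) {h : ℝ → ℝ≥0∞} (hh : Measurable h) :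
    ∫⁻ x, (Set.Ioi a).indicator (fun x => h (x - a)) x ∂expMeasure R =
      ENNReal.ofReal (Real.exp (-(R * a))) * ∫⁻ x, h x ∂expMeasure R := by
  have hm : Measurable fun x => h (x - a) := hh.comp (measurable_id.sub_const a)
  rw [lintegral_expMeasure R (hm.indicator measurableSet_Ioi),
    lintegral_expMeasure R hh, ← lintegral_const_mul' _ _ ENNReal.ofReal_ne_top,
    ← lintegral_indicator measurableSet_Ioi, ← lintegral_indicator measurableSet_Ioi,
    ← lintegral_add_right_eq_self _ a]
  refine lintegral_congr fun x => ?_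
  by_cases hx : 0 < x
  · have h1 : x + a ∈ Set.Ioi (0 : ℝ) := Set.mem_Ioi.2 (by linarith)
    have h2 : x + a ∈ Set.Ioi a := Set.mem_Ioi.2 (by linarith)
    rw [Set.indicator_of_mem h1, Set.indicator_of_mem h2, Set.indicator_of_mem (Set.mem_Ioi.2 hx),
      ← mul_assoc, ← ENNReal.ofReal_mul (Real.exp_pos _).le, add_sub_cancel_right]
    congr 2
    rw [mul_left_comm, ← Real.exp_add]
    ring_nf
  · have h2 : x + a ∉ Set.Ioi a := fun h => hx (by linarith [Set.mem_Ioi.1 h])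
    rw [Set.indicator_of_notMem (show x ∉ Set.Ioi (0 : ℝ) from hx)]
    by_cases h1 : x + a ∈ Set.Ioi (0 : ℝ)
    · rw [Set.indicator_of_mem h1, Set.indicator_of_notMem h2, mul_zero]
    · rw [Set.indicator_of_notMem h1]

/-- The weight of `k` under the Poisson distribution with mean `R * t`. -/
def poissonWeight (R t : ℝ) (k : ℕ) : ℝ := Real.exp (-(R * t)) * (R * t) ^ k / (k.factorial : ℝ)

lemma measurable_poissonWeight (R : ℝ) (k : ℕ) : Measurable fun t => poissonWeight R t k := by
  unfold poissonWeight; fun_prop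

lemma expMeasure_Ioi {R : ℝ} (hR : 0 < R) {a : ℝ} (ha : 0 ≤ a) :
    expMeasure R (Set.Ioi a) = ENNReal.ofReal (Real.exp (-(R * a))) := by
  have := isProbabilityMeasure_expMeasure hR
  have h := lintegral_expMeasure_sub R ha (h := 1) measurable_one
  simpa [lintegral_indicator_one measurableSet_Ioi] using h

/-- The Poisson recursion from conditioning on the first ring: `k + 1` rings up to `t` mean a first
ring at some `x ≤ t` and `k` rings in the remaining `t - x`. The exponentials combine to a constant,
leaving a polynomial to integrate. -/
lemma lintegral_poissonWeight {R : ℝ} (hR : 0 < R) (k : ℕ) {t : ℝ} (ht : 0 ≤ t) :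
    ∫⁻ x, (Set.Iic t).indicator (fun x => ENNReal.ofReal (poissonWeight R (t - x) k)) x
      ∂expMeasure R = ENNReal.ofReal (poissonWeight R t (k + 1)) := by
  have hm : Measurable fun x => ENNReal.ofReal (poissonWeight R (t - x) k) :=
    ((measurable_poissonWeight R k).comp (measurable_id.const_sub t)).ennreal_ofReal
  rw [lintegral_expMeasure R (hm.indicator measurableSet_Iic)]
  have hcont : Continuous fun x : ℝ => R * (Real.exp (-(R * t)) * (R * (t - x)) ^ k / (k.factorial : ℝ)) := by
    fun_prop
  have h1 : ∀ x : ℝ, (Set.Ioi (0 : ℝ)).indicator (fun x => ENNReal.ofReal (R * Real.exp (-(R * x))) *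
      (Set.Iic t).indicator (fun x => ENNReal.ofReal (poissonWeight R (t - x) k)) x) x =
      (Set.Ioc 0 t).indicator (fun x => ENNReal.ofReal
        (R * (Real.exp (-(R * t)) * (R * (t - x)) ^ k / (k.factorial : ℝ)))) x := by
    intro x
    by_cases h0 : 0 < x
    · by_cases hx : x ≤ t
      · rw [Set.indicator_of_mem (Set.mem_Ioi.2 h0), Set.indicator_of_mem (Set.mem_Iic.2 hx),
          Set.indicator_of_mem (Set.mem_Ioc.2 ⟨h0, hx⟩), ← ENNReal.ofReal_mul (by positivity)]
        congr 1
        rw [poissonWeight, show -(R * t) = -(R * x) + -(R * (t - x)) by ring, Real.exp_add]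
        ring
      · rw [Set.indicator_of_mem (Set.mem_Ioi.2 h0),
          Set.indicator_of_notMem (show x ∉ Set.Iic t from hx),
          Set.indicator_of_notMem (fun h : x ∈ Set.Ioc 0 t => hx h.2), mul_zero]
    · rw [Set.indicator_of_notMem (show x ∉ Set.Ioi (0 : ℝ) from h0),
        Set.indicator_of_notMem (fun h : x ∈ Set.Ioc 0 t => h0 h.1)]
  rw [← lintegral_indicator measurableSet_Ioi, lintegral_congr h1,
    lintegral_indicator measurableSet_Ioc, ← ofReal_integral_eq_lintegral_ofReal]
  · congr 1
    rw [← intervalIntegral.integral_of_le ht]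
    have hd : ∀ x ∈ Set.uIcc 0 t, HasDerivAt
        (fun x => -(Real.exp (-(R * t)) * (R * (t - x)) ^ (k + 1) / ((k + 1).factorial : ℝ)))
        (R * (Real.exp (-(R * t)) * (R * (t - x)) ^ k / (k.factorial : ℝ))) x := by
      intro x _
      have h2 : HasDerivAt (fun x => R * (t - x)) (R * (-1)) x :=
        ((hasDerivAt_id x).const_sub t).const_mul R
      have h3 := (((h2.pow (k + 1)).const_mul (Real.exp (-(R * t)))).div_const
        ((k + 1).factorial : ℝ)).neg
      convert! h3 using 1
      rw [Nat.factorial_succ]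
      push_cast
      have : (k.factorial : ℝ) ≠ 0 := by positivity
      have : (k : ℝ) + 1 ≠ 0 := by positivity
      field_simp
    rw [intervalIntegral.integral_eq_sub_of_hasDerivAt hd (hcont.intervalIntegrable _ _)]
    simp [poissonWeight]
  · exact (hcont.integrableOn_Icc (a := 0) (b := t)).mono_set Set.Ioc_subset_Icc_self
  · filter_upwards [ae_restrict_mem measurableSet_Ioc] with x hx
    have : 0 ≤ t - x := by linarith [hx.2]
    positivity

end ExpClock

/-! ### Paths driven by a sequence of waiting times and letters -/

namespace Uniformization

open IIDSeq

variable {U F : Type*}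

/-- The time of the `k`-th ring. -/
def clock (ω : ℕ → ℝ × U) (k : ℕ) : ℝ := ∑ i ∈ Finset.range k, (ω i).1

/-- The number of rings up to time `t`. -/
def count (t : ℝ) (ω : ℕ → ℝ × U) : ℕ := sInf {k | t < clock ω (k + 1)}

/-- The state reached from `z` after reading `k` letters. -/
def run (step : F → U → F) (z : F) (ω : ℕ → ℝ × U) : ℕ → F
  | 0 => z
  | k + 1 => step (run step z ω k) (ω k).2

/-- There are exactly `m` rings up to time `t`. -/
def hold (t : ℝ) (m : ℕ) : Set (ℕ → ℝ × U) :=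
  {ω | (∀ k < m, clock ω (k + 1) ≤ t) ∧ t < clock ω (m + 1)}

lemma clock_zero (ω : ℕ → ℝ × U) : clock ω 0 = 0 := by simp [clock]

lemma clock_succ (ω : ℕ → ℝ × U) (k : ℕ) : clock ω (k + 1) = clock ω k + (ω k).1 := by
  simp [clock, Finset.sum_range_succ]

lemma clock_cons (w : ℝ × U) (ω : ℕ → ℝ × U) (k : ℕ) :
    clock (cons w ω) (k + 1) = w.1 + clock ω k := by
  rw [clock, Finset.sum_range_succ', add_comm]; rfl

lemma clock_congr {m : ℕ} {ω ω' : ℕ → ℝ × U} (h : ∀ i < m, ω i = ω' i) {k : ℕ} (hk : k ≤ m) :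
    clock ω k = clock ω' k :=
  Finset.sum_congr rfl fun i hi => by rw [h i ((Finset.mem_range.1 hi).trans_le hk)]

lemma clock_add (ω : ℕ → ℝ × U) (m k : ℕ) : clock ω (m + k) = clock ω m + clock (shift m ω) k := by
  simp [clock, Finset.sum_range_add, shift]

lemma clock_glue_add (m k : ℕ) (ω ω' : ℕ → ℝ × U) :
    clock (glue m (ω, ω')) (m + k) = clock ω m + clock ω' k := by
  rw [clock_add, shift_glue, clock_congr (fun i hi => glue_of_lt hi ω ω') le_rfl]

variable (step : F → U → F)

lemma run_cons (z : F) (w : ℝ × U) (ω : ℕ → ℝ × U) (k : ℕ) :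
    run step z (cons w ω) (k + 1) = run step (step z w.2) ω k := by
  induction k with
  | zero => rfl
  | succ k ih => rw [run, ih]; rfl

lemma run_congr {m : ℕ} {ω ω' : ℕ → ℝ × U} (h : ∀ i < m, ω i = ω' i) (z : F) {k : ℕ} (hk : k ≤ m) :
    run step z ω k = run step z ω' k := by
  induction k with
  | zero => rfl
  | succ k ih => rw [run, run, ih (by omega), h k (by omega)]

lemma run_add (z : F) (ω : ℕ → ℝ × U) (m k : ℕ) :
    run step z ω (m + k) = run step (run step z ω m) (shift m ω) k := by
  induction k with
  | zero => rfl
  | succ k ih => rw [← add_assoc, run, ih]; rfl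

lemma run_glue_add (z : F) (m k : ℕ) (ω ω' : ℕ → ℝ × U) :
    run step z (glue m (ω, ω')) (m + k) = run step (run step z ω m) ω' k := by
  rw [run_add, shift_glue, run_congr step (fun i hi => glue_of_lt hi ω ω') z le_rfl]

lemma count_eq_of_mem_hold {t : ℝ} {m : ℕ} {ω : ℕ → ℝ × U} (h : ω ∈ hold t m) : count t ω = m := by
  refine le_antisymm (Nat.sInf_le h.2) ?_
  refine le_csInf ⟨m, h.2⟩ fun k hk => ?_
  by_contra hkm
  exact absurd hk (not_lt.2 (h.1 k (not_le.1 hkm)))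

lemma mem_hold_count {t : ℝ} {ω : ℕ → ℝ × U} (h : ∃ k, t < clock ω (k + 1)) :
    ω ∈ hold t (count t ω) :=
  ⟨fun _ hk => not_lt.1 (Nat.notMem_of_lt_sInf hk), Nat.sInf_mem (s := {k | t < clock ω (k + 1)}) h⟩

lemma count_add_cons (a t τ : ℝ) (x : U) (ω : ℕ → ℝ × U) :
    count (a + t) (cons (τ, x) ω) = count t (cons (τ - a, x) ω) := by
  simp only [count, clock_cons]
  congr 1; ext k
  simp only [Set.mem_ofPred_eq]
  constructor <;> intro h <;> linarith

lemma count_add_of_mem {t s : ℝ} {m : ℕ} {ω ω' : ℕ → ℝ × U} (hts : s ≤ t)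
    (hω : ∀ k < m, clock ω (k + 1) ≤ s) (hω' : ∃ k, t - clock ω m < clock ω' (k + 1)) :
    count t (glue m (ω, ω')) = m + count (t - clock ω m) ω' := by
  refine count_eq_of_mem_hold ⟨fun k hk => ?_, ?_⟩
  · rcases lt_or_ge k m with h | h
    · rw [clock_congr (fun i hi => glue_of_lt hi ω ω') h]
      exact (hω k h).trans hts
    · obtain ⟨j, rfl⟩ := Nat.exists_eq_add_of_le h
      rw [add_assoc, clock_glue_add]
      linarith [(mem_hold_count hω').1 j (by omega)]
  · rw [add_assoc, clock_glue_add]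
    linarith [(mem_hold_count hω').2]

/-- With exactly `m` rings up to `s`, the length of the next waiting time is invisible before `s`;
hence the first `m` letters determine everything observed up to that time. -/
lemma count_congr {s t : ℝ} (hts : t ≤ s) {m : ℕ} {ω ω' : ℕ → ℝ × U} (h : ∀ i < m, ω i = ω' i)
    (hω : ω ∈ hold s m) (hω' : ω' ∈ hold s m) : count t ω = count t ω' ∧ count t ω ≤ m := by
  have hle : ∀ ω'' : ℕ → ℝ × U, ω'' ∈ hold s m → count t ω'' ≤ m := fun ω'' h =>
    Nat.sInf_le (hts.trans_lt h.2)
  have key : ∀ ω₁ ω₂ : ℕ → ℝ × U, (∀ i < m, ω₁ i = ω₂ i) → ω₁ ∈ hold s m → ω₂ ∈ hold s m →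
      count t ω₁ ≤ count t ω₂ := by
    intro ω₁ ω₂ h h₁ h₂
    rcases (hle ω₂ h₂).lt_or_eq with hlt | heq
    · refine Nat.sInf_le ?_
      change t < _
      rw [clock_congr h hlt]
      exact (mem_hold_count ⟨m, hts.trans_lt h₂.2⟩).2
    · exact heq ▸ hle ω₁ h₁
  exact ⟨le_antisymm (key ω ω' h hω hω') (key ω' ω (fun i hi => (h i hi).symm) hω' hω), hle ω hω⟩

section Paths

variable {ω : ℕ → ℝ × U}

lemma strictMono_clock (hpos : ∀ i, 0 < (ω i).1) : StrictMono (clock ω) :=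
  strictMono_nat_of_lt_succ fun k => by rw [clock_succ]; linarith [hpos k]

lemma mem_hold_of_mem_Ico (hpos : ∀ i, 0 < (ω i).1) {t : ℝ} {m : ℕ} (h : t ∈ Set.Ico (clock ω m) (clock ω (m + 1))) :
    ω ∈ hold t m :=
  ⟨fun _ hk => ((strictMono_clock hpos).monotone hk).trans h.1, h.2⟩

lemma count_zero (hpos : ∀ i, 0 < (ω i).1) : count 0 ω = 0 :=
  count_eq_of_mem_hold (mem_hold_of_mem_Ico hpos
    ⟨(clock_zero ω).le, by rw [clock_succ, clock_zero]; linarith [hpos 0]⟩)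

lemma eventually_count_right (hunb : ∀ t, ∃ k, t < clock ω (k + 1)) (t : ℝ≥0) :
    ∀ᶠ s : ℝ≥0 in 𝓝[>] t, count s ω = count t ω := by
  have hm := mem_hold_count (hunb t)
  have h1 : ∀ᶠ s : ℝ≥0 in 𝓝[>] t, (s : ℝ) < clock ω (count t ω + 1) :=
    (NNReal.continuous_coe.tendsto t).eventually_lt_const hm.2 |>.filter_mono nhdsWithin_le_nhds
  filter_upwards [h1, self_mem_nhdsWithin] with s hs hts
  exact count_eq_of_mem_hold ⟨fun k hk => (hm.1 k hk).trans (NNReal.coe_le_coe.2 (le_of_lt hts)), hs⟩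

lemma eventually_count_left (hunb : ∀ t, ∃ k, t < clock ω (k + 1)) (t : ℝ≥0) :
    ∃ m, ∀ᶠ s : ℝ≥0 in 𝓝[<] t, count s ω = m := by
  classical
  -- The weak inequality is deliberate: the least such `k` counts the rings strictly before `t`,
  -- which is the left limit even when `t` is itself a ring.
  have hex : ∃ k, (t : ℝ) ≤ clock ω (k + 1) := (hunb t).imp fun k hk => hk.le
  refine ⟨Nat.find hex, ?_⟩
  have h1 : ∀ᶠ s : ℝ≥0 in 𝓝[<] t, ∀ k < Nat.find hex, clock ω (k + 1) ≤ s := by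
    refine (Set.finite_Iio (Nat.find hex)).eventually_all.2 fun k hk => ?_
    have hk' : clock ω (k + 1) < t := not_le.1 (Nat.find_min hex hk)
    exact ((NNReal.continuous_coe.tendsto t).eventually_const_lt hk').filter_mono
      nhdsWithin_le_nhds |>.mono fun _ h => h.le
  filter_upwards [h1, self_mem_nhdsWithin] with s hs hst
  exact count_eq_of_mem_hold ⟨hs, (NNReal.coe_lt_coe.2 hst).trans_le (Nat.find_spec hex)⟩

lemma exists_forall_le_count (hpos : ∀ i, 0 < (ω i).1)
    (hunb : ∀ t, ∃ k, t < clock ω (k + 1)) (K : ℕ) :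
    ∃ T : ℝ≥0, 0 < T ∧ ∀ t : ℝ≥0, T ≤ t → K ≤ count t ω := by
  -- The summand 1 only makes the time strictly positive, as `couplingTime` demands.
  refine ⟨Real.toNNReal (clock ω K) + 1, by positivity, fun t ht => ?_⟩
  by_contra hlt
  have h1 : (t : ℝ) < clock ω (count t ω + 1) := (mem_hold_count (hunb t)).2
  have h2 : clock ω (count t ω + 1) ≤ clock ω K := (strictMono_clock hpos).monotone (not_le.1 hlt)
  have h3 : ((Real.toNNReal (clock ω K) + 1 : ℝ≥0) : ℝ) ≤ t := NNReal.coe_le_coe.2 ht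
  push_cast at h3
  linarith [Real.le_coe_toNNReal (clock ω K)]

end Paths

end Uniformization

/-! ### The law of the uniformized chain at a fixed time -/

namespace Uniformization

open IIDSeq ExpClock ProbabilityTheory

instance (R : ℝ) [hR : Fact (0 < R)] : IsProbabilityMeasure (expMeasure R) :=
  isProbabilityMeasure_expMeasure hR.out

variable {U F E : Type*} [MeasurableSpace U]

/-- The law of a waiting time together with an independent letter. -/
def letterLaw (R : ℝ) (p : PMF U) : Measure (ℝ × U) := (expMeasure R).prod p.toMeasure

instance (R : ℝ) [Fact (0 < R)] (p : PMF U) : IsProbabilityMeasure (letterLaw R p) := by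
  unfold letterLaw; infer_instance

/-- The `k`-step transition probabilities. -/
def iter (Q : E → PMF E) : ℕ → E → PMF E
  | 0, x => PMF.pure x
  | k + 1, x => (Q x).bind (iter Q k)

/-- The transition function of the chain `Q` run at the rings of a rate `R` clock. -/
def transition (R : ℝ) (Q : E → PMF E) (t : ℝ≥0) (x : E) : PMF E :=
  (poissonMeasure (R.toNNReal * t)).toPMF.bind fun k => iter Q k x

lemma transition_apply {R : ℝ} (hR : 0 < R) (Q : E → PMF E) (t : ℝ≥0) (x y : E) :
    transition R Q t x y = ∑' k, ENNReal.ofReal (poissonWeight R t k) * iter Q k x y := by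
  rw [transition, PMF.bind_apply]
  refine tsum_congr fun k => ?_
  rw [Measure.toPMF_apply, poissonMeasure_singleton, poissonWeight]
  simp [Real.coe_toNNReal R hR.le]

lemma measurable_clock (k : ℕ) : Measurable fun ω : ℕ → ℝ × U => clock ω k :=
  Finset.measurable_sum _ fun i _ => measurable_fst.comp (measurable_pi_apply i)

lemma measurableSet_hold (t : ℝ) (m : ℕ) : MeasurableSet (hold t m : Set (ℕ → ℝ × U)) := by
  have : (hold t m : Set (ℕ → ℝ × U)) =
      (⋂ k, ⋂ (_ : k < m), {ω | clock ω (k + 1) ≤ t}) ∩ {ω | t < clock ω (m + 1)} := by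
    ext ω; simp [hold]
  rw [this]
  exact (MeasurableSet.iInter fun k => MeasurableSet.iInter fun _ =>
    measurableSet_le (measurable_clock _) measurable_const).inter
    (measurableSet_lt measurable_const (measurable_clock _))

lemma measurable_count (t : ℝ) : Measurable (count t : (ℕ → ℝ × U) → ℕ) := by
  refine measurable_to_countable' fun m => ?_
  have hS : MeasurableSet {ω : ℕ → ℝ × U | ∃ k, t < clock ω (k + 1)} := by
    have : {ω : ℕ → ℝ × U | ∃ k, t < clock ω (k + 1)} = ⋃ k, {ω | t < clock ω (k + 1)} := by
      ext; simp
    rw [this]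
    exact MeasurableSet.iUnion fun k => measurableSet_lt measurable_const (measurable_clock _)
  have : count t ⁻¹' {m} = (hold t m : Set (ℕ → ℝ × U)) ∪
      ({ω | ∃ k, t < clock ω (k + 1)}ᶜ ∩ {_ω | m = 0}) := by
    ext ω
    simp only [Set.mem_preimage, Set.mem_singleton_iff, Set.mem_union, Set.mem_inter_iff,
      Set.mem_compl_iff, Set.mem_ofPred_eq]
    by_cases h : ∃ k, t < clock ω (k + 1)
    · constructor
      · rintro rfl; exact Or.inl (mem_hold_count h)
      · rintro (h' | h')
        · exact count_eq_of_mem_hold h'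
        · exact absurd h h'.1
    -- If the clock never passes `t`, the infimum is over the empty set and takes the value 0.
    · have h0 : count t ω = 0 := by
        have : {k | t < clock ω (k + 1)} = ∅ := by
          ext k; simpa using fun hk => h ⟨k, hk⟩
        rw [count, this, Nat.sInf_empty]
      rw [h0]
      constructor
      · rintro rfl; exact Or.inr ⟨h, rfl⟩
      · rintro (h' | h')
        · exact absurd ⟨m, h'.2⟩ h
        · exact h'.2.symm
  rw [this]
  exact (measurableSet_hold t m).union (hS.compl.inter (MeasurableSet.const _))

variable [MeasurableSingletonClass U] [Countable U] [Countable F]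

lemma measurable_run [MeasurableSpace F] [DiscreteMeasurableSpace F] (step : F → U → F) (z : F)
    (k : ℕ) : Measurable fun ω : ℕ → ℝ × U => run step z ω k := by
  induction k with
  | zero => exact measurable_const
  | succ k ih =>
    exact (Measurable.of_discrete (f := fun q : F × U => step q.1 q.2)).comp
      (ih.prodMk (measurable_snd.comp (measurable_pi_apply k)))

lemma measurableSet_run (step : F → U → F) (z : F) (k : ℕ) (G : Set F) :
    MeasurableSet {ω : ℕ → ℝ × U | run step z ω k ∈ G} := by
  let _ : MeasurableSpace F := ⊤
  have : DiscreteMeasurableSpace F := ⟨fun _ => trivial⟩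
  exact measurable_run step z k (MeasurableSet.of_discrete (s := G))

lemma measurableSet_run_count (step : F → U → F) (z : F) (t : ℝ) (G : Set F) :
    MeasurableSet {ω : ℕ → ℝ × U | run step z ω (count t ω) ∈ G} := by
  have : {ω : ℕ → ℝ × U | run step z ω (count t ω) ∈ G} =
      ⋃ m, (count t ⁻¹' {m} ∩ {ω | run step z ω m ∈ G}) := by
    ext ω; simp
  rw [this]
  exact MeasurableSet.iUnion fun m =>
    (measurable_count t (measurableSet_singleton m)).inter (measurableSet_run step z m G)

lemma letterLaw_ne_zero (R : ℝ) [Fact (0 < R)] (p : PMF U) {A : Set ℝ} (hA : expMeasure R A ≠ 0) {x : U} (hx : p x ≠ 0) :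
    letterLaw R p (A ×ˢ {x}) ≠ 0 := by
  rw [letterLaw, Measure.prod_prod, PMF.toMeasure_apply_singleton _ _ (measurableSet_singleton x)]
  exact mul_ne_zero hA hx

variable (R : ℝ) [hR : Fact (0 < R)] (p : PMF U)

lemma ae_pos : ∀ᵐ ω ∂law (letterLaw R p), ∀ i, 0 < (ω i).1 := by
  refine ae_all_iff.2 fun i => ?_
  have h : ∀ᵐ w ∂letterLaw R p, 0 < w.1 := by
    have h1 : ∀ᵐ τ ∂expMeasure R, 0 < τ := by
      have := expMeasure_Ioi hR.out le_rfl
      rw [mul_zero, neg_zero, Real.exp_zero, ENNReal.ofReal_one] at this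
      exact (prob_compl_eq_zero_iff measurableSet_Ioi).2 this
    exact Measure.quasiMeasurePreserving_fst.ae h1
  exact (measurePreserving_eval_infinitePi (fun _ : ℕ => letterLaw R p) i).quasiMeasurePreserving.ae h

/-- No explosion: a waiting time exceeds 1 with positive probability, so arbitrarily long blocks of
such waiting times occur almost surely. -/
lemma ae_unbounded : ∀ᵐ ω ∂law (letterLaw R p), ∀ t, ∃ k, t < clock ω (k + 1) := by
  have h : ∀ᵐ ω ∂law (letterLaw R p), ∀ m : ℕ, ∃ q, ∀ i < m,
      ω (q + i) ∈ (Set.Ioi (1 : ℝ) ×ˢ (Set.univ : Set U)) := by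
    refine ae_all_iff.2 fun m => ae_exists_word _
      (fun _ => measurableSet_Ioi.prod MeasurableSet.univ) m fun i _ => ?_
    rw [letterLaw, Measure.prod_prod, measure_univ, mul_one, expMeasure_Ioi hR.out zero_le_one]
    simpa using Real.exp_pos _
  filter_upwards [h, ae_pos R p] with ω hω hpos t
  obtain ⟨m, hm⟩ := exists_nat_gt (max t 0)
  obtain ⟨q, hq⟩ := hω m
  have h1 : (m : ℝ) ≤ clock (shift q ω) m := by
    have := Finset.card_nsmul_le_sum (Finset.range m) (fun i => (shift q ω i).1) 1
      fun i hi => (hq i (Finset.mem_range.1 hi)).1.le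
    simpa [clock] using this
  have h2 : 0 ≤ clock ω q := Finset.sum_nonneg fun i _ => (hpos i).le
  have h3 := (strictMono_clock hpos) (Nat.lt_succ_self (q + m))
  refine ⟨q + m, ?_⟩
  rw [clock_add] at h3
  linarith [le_max_left t 0]

lemma measure_eq_tsum_hold (t : ℝ) {A : Set (ℕ → ℝ × U)} (hA : MeasurableSet A) :
    law (letterLaw R p) A = ∑' m, law (letterLaw R p) (A ∩ hold t m) := by
  rw [← measure_iUnion]
  · refine measure_congr ?_
    filter_upwards [ae_unbounded R p] with ω hω
    refine propext ⟨fun h => Set.mem_iUnion.2 ⟨count t ω, h, mem_hold_count (hω t)⟩, fun h => ?_⟩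
    obtain ⟨m, hm⟩ := Set.mem_iUnion.1 h
    exact hm.1
  · intro i j hij
    refine Set.disjoint_left.2 fun ω h1 h2 => hij ?_
    rw [← count_eq_of_mem_hold h1.2, ← count_eq_of_mem_hold h2.2]
  · exact fun m => hA.inter (measurableSet_hold t m)

lemma lintegral_letterLaw {f : ℝ × U → ℝ≥0∞} (hf : Measurable f) :
    ∫⁻ w, f w ∂letterLaw R p = ∑' x, p x * ∫⁻ τ, f (τ, x) ∂expMeasure R := by
  rw [letterLaw, lintegral_prod_symm _ hf.aemeasurable, lintegral_countable']
  refine tsum_congr fun x => ?_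
  rw [PMF.toMeasure_apply_singleton _ _ (measurableSet_singleton x), mul_comm]

lemma measurable_law_cons {B : Set (ℕ → ℝ × U)} (hB : MeasurableSet B) :
    Measurable fun w => law (letterLaw R p) {ω' | cons w ω' ∈ B} :=
  measurable_measure_prodMk_left (ν := law (letterLaw R p)) (measurable_cons hB)

variable {step : F → U → F} {φ : F → E} {Q : E → PMF E}

/-- Induction on the number of rings, conditioning on the first waiting time and letter. The
hypothesis `hQ` is lumpability: the law of the next image depends on the image alone. The state and
the remaining time stay general because the first letter changes both. -/
lemma law_hold_run (hQ : ∀ z, Q (φ z) = p.map fun x => φ (step z x)) (y : E) (k : ℕ) :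
    ∀ (z : F) (t : ℝ), 0 ≤ t →
      law (letterLaw R p) ({ω | φ (run step z ω k) = y} ∩ hold t k) =
        ENNReal.ofReal (poissonWeight R t k) * iter Q k (φ z) y := by
  classical
  have hmeas : ∀ (z : F) (t : ℝ) (k : ℕ), MeasurableSet
      ({ω : ℕ → ℝ × U | φ (run step z ω k) = y} ∩ hold t k) := fun z t k =>
    (measurableSet_run step z k {z | φ z = y}).inter (measurableSet_hold t k)
  induction k with
  | zero =>
    intro z t ht
    rw [law_apply_eq_cons _ (hmeas z t 0)]
    have h1 : ∀ w : ℝ × U, law (letterLaw R p)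
        {ω' | cons w ω' ∈ {ω | φ (run step z ω 0) = y} ∩ hold t 0} =
        (Set.Ioi t ×ˢ Set.univ).indicator (fun _ => PMF.pure (φ z) y) w := by
      intro w
      have h2 : {ω' | cons w ω' ∈ {ω | φ (run step z ω 0) = y} ∩ hold t 0} =
          {_ω' | φ z = y ∧ t < w.1} := by
        ext ω'
        simp [hold, run, clock]
      rw [h2]
      by_cases hy : φ z = y <;> by_cases hw : t < w.1 <;>
        simp [hy, hw, Set.indicator, PMF.pure_apply]
      exact fun h => absurd h.symm hy
    rw [lintegral_congr h1, lintegral_indicator (measurableSet_Ioi.prod MeasurableSet.univ),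
      lintegral_const, Measure.restrict_apply_univ, letterLaw, Measure.prod_prod, measure_univ,
      mul_one, expMeasure_Ioi hR.out ht, mul_comm]
    simp [poissonWeight, iter]
  | succ k ih =>
    intro z t ht
    rw [law_apply_eq_cons _ (hmeas z t (k + 1)),
      lintegral_letterLaw _ _ (measurable_law_cons R p (hmeas z t (k + 1)))]
    have h1 : ∀ (x : U) (τ : ℝ), law (letterLaw R p)
        {ω' | cons (τ, x) ω' ∈ {ω | φ (run step z ω (k + 1)) = y} ∩ hold t (k + 1)} =
        (Set.Iic t).indicator (fun τ => ENNReal.ofReal (poissonWeight R (t - τ) k)) τ *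
          iter Q k (φ (step z x)) y := by
      intro x τ
      by_cases hτ : τ ≤ t
      · rw [Set.indicator_of_mem (Set.mem_Iic.2 hτ), ← ih (step z x) (t - τ) (by linarith)]
        congr 1
        ext ω'
        simp only [Set.mem_ofPred_eq, Set.mem_inter_iff, run_cons, hold, clock_cons]
        refine and_congr_right fun _ => and_congr ⟨fun h j hj => ?_, fun h j hj => ?_⟩ ?_
        · linarith [h (j + 1) (by omega)]
        · cases j with
          | zero => rw [clock_zero]; linarith
          | succ j => linarith [h j (by omega)]
        · constructor <;> intro h <;> linarith
      · rw [Set.indicator_of_notMem (show τ ∉ Set.Iic t from hτ), zero_mul]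
        rw [← measure_empty (μ := law (letterLaw R p))]
        congr 1
        ext ω'
        simp only [Set.mem_ofPred_eq, Set.mem_inter_iff, hold, clock_cons, Set.mem_empty_iff_false,
          iff_false, not_and]
        intro _ h
        have := h 0 (Nat.succ_pos k)
        rw [clock_zero] at this
        exact absurd (by linarith) hτ
    have hm : Measurable ((Set.Iic t).indicator
        fun τ => ENNReal.ofReal (poissonWeight R (t - τ) k)) :=
      ((measurable_poissonWeight R k).comp
        (measurable_id.const_sub t)).ennreal_ofReal.indicator measurableSet_Iic
    simp only [h1]
    simp only [lintegral_mul_const _ hm, lintegral_poissonWeight hR.out k ht]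
    rw [iter, hQ z, PMF.bind_map, PMF.bind_apply, ← ENNReal.tsum_mul_left]
    exact tsum_congr fun x => mul_left_comm _ _ _

lemma law_run_count (hQ : ∀ z, Q (φ z) = p.map fun x => φ (step z x)) (z : F) (t : ℝ≥0) (y : E) :
    law (letterLaw R p) {ω | φ (run step z ω (count t ω)) = y} = transition R Q t (φ z) y := by
  have hm : MeasurableSet {ω : ℕ → ℝ × U | φ (run step z ω (count t ω)) = y} :=
    measurableSet_run_count step z t {z | φ z = y}
  rw [measure_eq_tsum_hold R p t hm, transition_apply hR.out]
  refine tsum_congr fun k => ?_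
  rw [← law_hold_run R p hQ y k z t t.2]
  congr 1
  ext ω
  refine and_congr_left fun h => ?_
  simp only [Set.mem_ofPred_eq, count_eq_of_mem_hold h]

/-- Absence of memory: on the event that the first ring comes after `a`, subtracting `a` from the
first waiting time restores its law and shifts the path by `a`. -/
lemma law_run_count_of_lt (hQ : ∀ z, Q (φ z) = p.map fun x => φ (step z x)) (z : F) {a : ℝ}
    (ha : 0 ≤ a) (t : ℝ≥0) (y : E) :
    law (letterLaw R p) {ω | a < (ω 0).1 ∧ φ (run step z ω (count (a + t) ω)) = y} =
      ENNReal.ofReal (Real.exp (-(R * a))) * transition R Q t (φ z) y := by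
  have hm : MeasurableSet {ω : ℕ → ℝ × U | φ (run step z ω (count t ω)) = y} :=
    measurableSet_run_count step z t {z | φ z = y}
  have hm' : MeasurableSet
      {ω : ℕ → ℝ × U | a < (ω 0).1 ∧ φ (run step z ω (count (a + t) ω)) = y} :=
    (measurableSet_lt measurable_const
      (measurable_fst.comp (measurable_pi_apply 0) : Measurable fun ω : ℕ → ℝ × U => (ω 0).1)).inter
      (measurableSet_run_count step z (a + t) {z | φ z = y})
  rw [← law_run_count R p hQ, law_apply_eq_cons _ hm, law_apply_eq_cons _ hm',
    lintegral_letterLaw _ _ (measurable_law_cons R p hm),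
    lintegral_letterLaw _ _ (measurable_law_cons R p hm'), ← ENNReal.tsum_mul_left]
  refine tsum_congr fun x => ?_
  have hx : Measurable fun τ : ℝ => law (letterLaw R p)
      {ω' | cons (τ, x) ω' ∈ {ω | φ (run step z ω (count t ω)) = y}} :=
    (measurable_law_cons R p hm).comp measurable_prodMk_right
  rw [mul_left_comm, ← lintegral_expMeasure_sub R ha hx]
  congr 1
  refine lintegral_congr fun τ => ?_
  by_cases hτ : a < τ
  · rw [Set.indicator_of_mem (Set.mem_Ioi.2 hτ)]
    refine congrArg (law (letterLaw R p)) ?_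
    ext ω
    have hrun : ∀ k, run step z (cons (τ, x) ω) k = run step z (cons (τ - a, x) ω) k := by
      intro k
      cases k with
      | zero => rfl
      | succ k => rw [run_cons, run_cons]
    simp [hτ, count_add_cons, hrun]
  · rw [Set.indicator_of_notMem (show τ ∉ Set.Ioi a from hτ)]
    simp [hτ]

end Uniformization

/-! ### The generator and the Markov property -/

namespace Uniformization

open IIDSeq ExpClock ProbabilityTheory

section Generator

variable {E : Type*}

lemma summable_toReal_mul (q : PMF E) {f : E → ℝ} {C : ℝ} (hf : ∀ y, |f y| ≤ C) :
    Summable fun y => (q y).toReal * f y := by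
  refine Summable.of_norm_bounded ((ENNReal.summable_toReal q.tsum_coe_ne_top).mul_right C)
    fun y => ?_
  rw [Real.norm_eq_abs, abs_mul, abs_of_nonneg ENNReal.toReal_nonneg]
  exact mul_le_mul_of_nonneg_left (hf y) ENNReal.toReal_nonneg

lemma tsum_toReal (q : PMF E) : ∑' y, (q y).toReal = 1 := by
  rw [← ENNReal.tsum_toReal_eq fun y => q.apply_ne_top y, q.tsum_coe, ENNReal.toReal_one]

/-- Removing the contributions of zero and one ring from the transition law leaves a nonnegative
measure, whose mass is the probability of at least two rings. -/
lemma abs_transition_sub_le {R : ℝ} (hR : 0 < R) (Q : E → PMF E) (t : ℝ≥0) (x : E) {f : E → ℝ}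
    {C : ℝ} (hf : ∀ y, |f y| ≤ C) :
    |∑' y, (transition R Q t x y).toReal * f y - poissonWeight R t 0 * f x
        - poissonWeight R t 1 * ∑' y, (Q x y).toReal * f y| ≤
      C * (1 - poissonWeight R t 0 - poissonWeight R t 1) := by
  have hw : ∀ k, 0 ≤ poissonWeight R t k := fun k => by unfold poissonWeight; positivity
  set r : E → ℝ := fun y => (transition R Q t x y).toReal
    - poissonWeight R t 0 * (PMF.pure x y).toReal - poissonWeight R t 1 * (Q x y).toReal with hr
  have hr0 : ∀ y, 0 ≤ r y := by
    intro y
    have h1 : ∑ k ∈ Finset.range 2, ENNReal.ofReal (poissonWeight R t k) * iter Q k x y ≤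
        transition R Q t x y := by
      rw [transition_apply hR]; exact ENNReal.sum_le_tsum _
    have h2 := ENNReal.toReal_mono (PMF.apply_ne_top _ _) h1
    have h3 : iter Q 1 x = Q x := by
      change (Q x).bind (fun y => PMF.pure y) = Q x
      exact PMF.bind_pure _
    rw [ENNReal.toReal_sum fun k _ =>
      ENNReal.mul_ne_top ENNReal.ofReal_ne_top (PMF.apply_ne_top _ _)] at h2
    simp only [Finset.sum_range_succ, Finset.range_zero, Finset.sum_empty, zero_add,
      ENNReal.toReal_mul, ENNReal.toReal_ofReal (hw _), h3] at h2
    rw [iter] at h2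
    simp only [hr]
    linarith
  have s1 := ENNReal.summable_toReal (transition R Q t x).tsum_coe_ne_top
  have s2 := (ENNReal.summable_toReal (PMF.pure x).tsum_coe_ne_top).mul_left (poissonWeight R t 0)
  have s3 := (ENNReal.summable_toReal (Q x).tsum_coe_ne_top).mul_left (poissonWeight R t 1)
  have hrs : Summable r := (s1.sub s2).sub s3
  have hrsum : ∑' y, r y = 1 - poissonWeight R t 0 - poissonWeight R t 1 := by
    simp only [hr]
    rw [(s1.sub s2).tsum_sub s3, s1.tsum_sub s2, tsum_mul_left, tsum_mul_left, tsum_toReal,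
      tsum_toReal, tsum_toReal, mul_one, mul_one]
  have t1 := summable_toReal_mul (transition R Q t x) hf
  have t2 := (summable_toReal_mul (PMF.pure x) hf).mul_left (poissonWeight R t 0)
  have t3 := (summable_toReal_mul (Q x) hf).mul_left (poissonWeight R t 1)
  have hpure : ∑' y, (PMF.pure x y).toReal * f y = f x := by
    rw [tsum_eq_single x]
    · simp
    · intro y hy; simp [hy]
  have heq : ∑' y, (transition R Q t x y).toReal * f y - poissonWeight R t 0 * f x
        - poissonWeight R t 1 * ∑' y, (Q x y).toReal * f y = ∑' y, r y * f y := by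
    rw [← hpure, ← tsum_mul_left, ← tsum_mul_left, ← t1.tsum_sub t2, ← (t1.sub t2).tsum_sub t3]
    exact tsum_congr fun y => by simp only [hr]; ring
  rw [heq, ← hrsum, ← tsum_mul_left, ← Real.norm_eq_abs]
  refine tsum_of_norm_bounded (hrs.mul_left C).hasSum fun y => ?_
  rw [Real.norm_eq_abs, abs_mul, abs_of_nonneg (hr0 y), mul_comm]
  exact mul_le_mul_of_nonneg_right (hf y) (hr0 y)

lemma tendsto_transition {R : ℝ} (hR : 0 < R) (Q : E → PMF E) (x : E) {f : E → ℝ} {C : ℝ}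
    (hf : ∀ y, |f y| ≤ C) :
    Tendsto (fun t : ℝ≥0 => ((∑' y, (transition R Q t x y).toReal * f y) - f x) / (t : ℝ))
      (𝓝[>] 0) (𝓝 (R * (∑' y, (Q x y).toReal * f y - f x))) := by
  have hc : Tendsto (fun t : ℝ≥0 => (t : ℝ)) (𝓝[>] 0) (𝓝[≠] 0) := by
    refine tendsto_nhdsWithin_iff.2 ⟨?_, ?_⟩
    · exact (NNReal.continuous_coe.tendsto 0).mono_left nhdsWithin_le_nhds
    · filter_upwards [self_mem_nhdsWithin] with t ht
      exact NNReal.coe_ne_zero.2 (ne_of_gt ht)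
  have hlin : HasDerivAt (fun t : ℝ => R * t) R 0 := by
    simpa using (hasDerivAt_id (0 : ℝ)).const_mul R
  have hexp : HasDerivAt (fun t : ℝ => Real.exp (-(R * t))) (-R) 0 := by
    simpa using hlin.neg.exp
  have h0 : Tendsto (fun t : ℝ≥0 => (poissonWeight R t 0 - 1) / (t : ℝ)) (𝓝[>] 0) (𝓝 (-R)) := by
    refine ((hasDerivAt_iff_tendsto_slope_zero.1 hexp).comp hc).congr fun t => ?_
    simp [poissonWeight, div_eq_inv_mul]
  have h1 : Tendsto (fun t : ℝ≥0 => poissonWeight R t 1 / (t : ℝ)) (𝓝[>] 0) (𝓝 R) := by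
    have h : HasDerivAt (fun t : ℝ => Real.exp (-(R * t)) * (R * t)) R 0 := by
      convert! hexp.mul hlin using 1
      simp
    refine ((hasDerivAt_iff_tendsto_slope_zero.1 h).comp hc).congr fun t => ?_
    simp [poissonWeight, div_eq_inv_mul]
  set g := ∑' y, (Q x y).toReal * f y
  have hrest : Tendsto (fun t : ℝ≥0 => (∑' y, (transition R Q t x y).toReal * f y
      - poissonWeight R t 0 * f x - poissonWeight R t 1 * g) / (t : ℝ)) (𝓝[>] 0) (𝓝 0) := by
    -- The probability of two or more rings is `o(t)`, since the derivatives `-R` and `R` of the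
    -- first two weights cancel.
    have hb : Tendsto (fun t : ℝ≥0 => C * -((poissonWeight R t 0 - 1) / (t : ℝ)
        + poissonWeight R t 1 / (t : ℝ))) (𝓝[>] 0) (𝓝 0) := by
      simpa using ((h0.add h1).neg).const_mul C
    refine squeeze_zero_norm (fun t => ?_) hb
    rw [Real.norm_eq_abs, abs_div, NNReal.abs_eq]
    refine (div_le_div_of_nonneg_right (abs_transition_sub_le hR Q t x hf) t.coe_nonneg).trans_eq ?_
    ring
  have := (hrest.add (h0.mul_const (f x))).add (h1.mul_const g)
  refine (this.congr fun t => ?_).trans_eq ?_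
  · ring
  · ring_nf

end Generator

variable {U E : Type u} {F : Type*} [MeasurableSpace U] [MeasurableSingletonClass U] [Countable U]
  [Countable F]

/-- The events whose trace on `hold s m` is determined by the first `m` letters form a σ-algebra,
and by `count_congr` it contains the generators of the past. -/
lemma mem_iff_of_pastSigma {step : F → U → F} {φ : F → E} (z : F) (s : ℝ≥0)
    {A : Set (ℕ → ℝ × U)}
    (hA : MeasurableSet[pastSigma (fun (t : ℝ≥0) ω => φ (run step z ω (count t ω))) s] A) (m : ℕ) :
    MeasurableSet A ∧ ∀ ω ω', (∀ i < m, ω i = ω' i) → ω ∈ hold s m → ω' ∈ hold s m →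
      (ω ∈ A ↔ ω' ∈ A) := by
  let 𝒢 : MeasurableSpace (ℕ → ℝ × U) :=
    { MeasurableSet' := fun A => MeasurableSet A ∧ ∀ ω ω', (∀ i < m, ω i = ω' i) → ω ∈ hold s m →
        ω' ∈ hold s m → (ω ∈ A ↔ ω' ∈ A)
      measurableSet_empty := ⟨MeasurableSet.empty, fun _ _ _ _ _ => Iff.rfl⟩
      measurableSet_compl := fun A hA =>
        ⟨hA.1.compl, fun ω ω' h h1 h2 => by
          rw [Set.mem_compl_iff, Set.mem_compl_iff, hA.2 ω ω' h h1 h2]⟩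
      measurableSet_iUnion := fun A hA => ⟨MeasurableSet.iUnion fun i => (hA i).1,
        fun ω ω' h h1 h2 => by
          simp only [Set.mem_iUnion]
          exact exists_congr fun i => (hA i).2 ω ω' h h1 h2⟩ }
  have hle : pastSigma (fun (t : ℝ≥0) ω => φ (run step z ω (count t ω))) s ≤ 𝒢 := by
    refine iSup₂_le fun t ht => ?_
    rintro _ ⟨G, -, rfl⟩
    refine ⟨measurableSet_run_count step z t (φ ⁻¹' G), fun ω ω' h h1 h2 => ?_⟩
    obtain ⟨h3, h4⟩ := count_congr (NNReal.coe_le_coe.2 ht) h h1 h2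
    simp only [Set.mem_preimage, ← h3, run_congr step h z h4]
  exact hle A hA

variable (R : ℝ) [hR : Fact (0 < R)] (p : PMF U) {step : F → U → F} {φ : F → E} {Q : E → PMF E}

lemma law_first_gt {a : ℝ} (ha : 0 ≤ a) :
    law (letterLaw R p) {ω | a < (ω 0).1} = ENNReal.ofReal (Real.exp (-(R * a))) := by
  have h : {ω : ℕ → ℝ × U | a < (ω 0).1} =
      (fun ω => ω 0) ⁻¹' (Set.Ioi a ×ˢ Set.univ) := by
    ext ω; simp
  rw [h, (measurePreserving_eval_infinitePi (fun _ : ℕ => letterLaw R p) 0).measure_preimage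
    (measurableSet_Ioi.prod MeasurableSet.univ).nullMeasurableSet, letterLaw, Measure.prod_prod,
    measure_univ, mul_one, expMeasure_Ioi hR.out ha]

lemma mem_hold_glue {s : ℝ} {m : ℕ} {ω ω' : ℕ → ℝ × U} : glue m (ω, ω') ∈ hold s m ↔
    (∀ k < m, clock ω (k + 1) ≤ s) ∧ s - clock ω m < (ω' 0).1 := by
  have h1 : clock (glue m (ω, ω')) (m + 1) = clock ω m + (ω' 0).1 := by
    rw [clock_glue_add]; simp [clock]
  refine and_congr (forall₂_congr fun k hk => ?_) ?_
  · rw [clock_congr (fun i hi => glue_of_lt hi ω ω') hk]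
  · rw [h1, sub_lt_iff_lt_add']

/-- Split by the number `m` of rings up to `s` and freeze the first `m` letters. The past event is
then either impossible or reduces to the next waiting time outlasting the residual `s - clock ω m`,
after which `law_run_count_of_lt` restarts the chain. -/
lemma law_inter_run_count (hQ : ∀ z, Q (φ z) = p.map fun x => φ (step z x)) (z : F) (s t : ℝ≥0)
    {A : Set (ℕ → ℝ × U)}
    (hA : MeasurableSet[pastSigma (fun (t : ℝ≥0) ω => φ (run step z ω (count t ω))) s] A) (x y : E) :
    law (letterLaw R p) (A ∩ {ω | φ (run step z ω (count s ω)) = x} ∩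
        {ω | φ (run step z ω (count (s + t : ℝ≥0) ω)) = y}) =
      law (letterLaw R p) (A ∩ {ω | φ (run step z ω (count s ω)) = x}) * transition R Q t x y := by
  have hx : MeasurableSet {ω : ℕ → ℝ × U | φ (run step z ω (count s ω)) = x} :=
    measurableSet_run_count step z s {z | φ z = x}
  have hy : MeasurableSet {ω : ℕ → ℝ × U | φ (run step z ω (count (s + t : ℝ≥0) ω)) = y} :=
    measurableSet_run_count step z _ {z | φ z = y}
  have hAm := (mem_iff_of_pastSigma z s hA 0).1
  rw [measure_eq_tsum_hold R p s ((hAm.inter hx).inter hy),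
    measure_eq_tsum_hold R p s (hAm.inter hx), ← ENNReal.tsum_mul_right]
  refine tsum_congr fun m => ?_
  have hdet := (mem_iff_of_pastSigma z s hA m).2
  have hglue : ∀ B : Set (ℕ → ℝ × U), MeasurableSet B → law (letterLaw R p) B =
      ∫⁻ ω, law (letterLaw R p) {ω' | glue m (ω, ω') ∈ B} ∂law (letterLaw R p) := by
    intro B hB
    rw [← (measurePreserving_glue (letterLaw R p) m).measure_preimage hB.nullMeasurableSet,
      Measure.prod_apply (measurable_glue m hB)]
    rfl
  rw [hglue _ (((hAm.inter hx).inter hy).inter (measurableSet_hold _ _)),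
    hglue _ ((hAm.inter hx).inter (measurableSet_hold _ _)),
    ← lintegral_mul_const' _ _ (PMF.apply_ne_top _ _)]
  refine lintegral_congr fun ω => ?_
  have hrun : ∀ ω', glue m (ω, ω') ∈ hold s m →
      run step z (glue m (ω, ω')) (count s (glue m (ω, ω'))) = run step z ω m := fun ω' h => by
    rw [count_eq_of_mem_hold h, run_congr step (fun i hi => glue_of_lt hi ω ω') z le_rfl]
  by_cases hex : ∃ ω₀, glue m (ω, ω₀) ∈ A ∩ {ω | φ (run step z ω (count s ω)) = x} ∩ hold s m
  · obtain ⟨ω₀, ⟨h1, h2⟩, h3⟩ := hex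
    have hclock := (mem_hold_glue.1 h3).1
    have hxm : φ (run step z ω m) = x := by rw [← hrun ω₀ h3]; exact h2
    have ha : 0 ≤ (s : ℝ) - clock ω m := by
      cases m with
      | zero => rw [clock_zero, sub_zero]; exact s.2
      | succ k => linarith [hclock k (Nat.lt_succ_self k)]
    have hmem : ∀ ω', glue m (ω, ω') ∈ A ∩ {ω | φ (run step z ω (count s ω)) = x} ∩ hold s m ↔
        s - clock ω m < (ω' 0).1 := by
      intro ω'
      refine ⟨fun h => (mem_hold_glue.1 h.2).2, fun h => ?_⟩
      have h4 : glue m (ω, ω') ∈ hold s m := mem_hold_glue.2 ⟨hclock, h⟩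
      refine ⟨⟨(hdet _ _ (fun i hi => ?_) h3 h4).1 h1, ?_⟩, h4⟩
      · rw [glue_of_lt hi, glue_of_lt hi]
      · change φ _ = x
        rw [hrun ω' h4, hxm]
    have e2 : {ω' | glue m (ω, ω') ∈ A ∩ {ω | φ (run step z ω (count s ω)) = x} ∩ hold s m} =
        {ω' | s - clock ω m < (ω' 0).1} := by
      ext ω'; exact hmem ω'
    have e1 : law (letterLaw R p) {ω' | glue m (ω, ω') ∈
        A ∩ {ω | φ (run step z ω (count s ω)) = x} ∩
        {ω | φ (run step z ω (count (s + t : ℝ≥0) ω)) = y} ∩ hold s m} =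
        law (letterLaw R p) {ω' | s - clock ω m < (ω' 0).1 ∧
          φ (run step (run step z ω m) ω' (count ((s - clock ω m) + t) ω')) = y} := by
      refine measure_congr ?_
      filter_upwards [ae_unbounded R p] with ω' hω'
      refine propext ?_
      have h5 : count (s + t : ℝ≥0) (glue m (ω, ω')) = m + count ((s - clock ω m) + t) ω' := by
        rw [count_add_of_mem (s := s) (by push_cast; linarith [t.2]) hclock (hω' _)]
        congr 2
        push_cast
        ring
      change ((glue m (ω, ω') ∈ A ∩ {ω | φ (run step z ω (count s ω)) = x} ∧
        φ (run step z (glue m (ω, ω')) (count (s + t : ℝ≥0) (glue m (ω, ω')))) = y) ∧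
        glue m (ω, ω') ∈ hold s m) ↔ _
      rw [and_right_comm, h5, run_glue_add]
      exact and_congr_left fun _ => hmem ω'
    rw [e1, e2, law_run_count_of_lt R p hQ _ ha, law_first_gt R p ha, hxm]
  · have e1 : {ω' | glue m (ω, ω') ∈ A ∩ {ω | φ (run step z ω (count s ω)) = x} ∩
        {ω | φ (run step z ω (count (s + t : ℝ≥0) ω)) = y} ∩ hold s m} = ∅ :=
      Set.eq_empty_of_forall_notMem fun ω' h => hex ⟨ω', h.1.1, h.2⟩
    have e2 : {ω' | glue m (ω, ω') ∈ A ∩ {ω | φ (run step z ω (count s ω)) = x} ∩ hold s m} = ∅ :=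
      Set.eq_empty_of_forall_notMem fun ω' h => hex ⟨ω', h⟩
    rw [e1, e2, measure_empty, zero_mul]

/-- The semigroup law is read off the Markov property of the constructed process with the trivial
past event, so no convolution of Poisson weights is needed. -/
lemma isTransitionFunction (hφ : Function.Surjective φ)
    (hQ : ∀ z, Q (φ z) = p.map fun x => φ (step z x)) {L : (E → ℝ) → E → ℝ}
    (hL : ∀ f : E → ℝ, (∃ C, ∀ y, |f y| ≤ C) → ∀ x,
      L f x = R * (∑' y, (Q x y).toReal * f y - f x)) :
    IsTransitionFunction L (transition R Q) where
  zero x := by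
    refine PMF.ext fun y => ?_
    rw [transition_apply hR.out, tsum_eq_single 0]
    · simp [poissonWeight, iter]
    · intro k hk; simp [poissonWeight, hk]
  add s t x := by
    obtain ⟨z, rfl⟩ := hφ x
    have : Countable E := hφ.countable
    refine PMF.ext fun y => ?_
    have hy : MeasurableSet {ω : ℕ → ℝ × U | φ (run step z ω (count (s + t : ℝ≥0) ω)) = y} :=
      measurableSet_run_count step z _ {z | φ z = y}
    have hu : {ω : ℕ → ℝ × U | φ (run step z ω (count (s + t : ℝ≥0) ω)) = y} =
        ⋃ x, Set.univ ∩ {ω | φ (run step z ω (count s ω)) = x} ∩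
          {ω | φ (run step z ω (count (s + t : ℝ≥0) ω)) = y} := by
      ext ω; simp
    rw [← law_run_count R p hQ, hu, measure_iUnion, PMF.bind_apply]
    · refine tsum_congr fun x => ?_
      rw [law_inter_run_count R p hQ z s t MeasurableSet.univ, Set.univ_inter,
        law_run_count R p hQ]
    · intro x x' hne
      exact Set.disjoint_left.2 fun ω h h' => hne (h.1.2.symm.trans h'.1.2)
    · exact fun x => (MeasurableSet.univ.inter
        (measurableSet_run_count step z s {z | φ z = x})).inter hy
  generator f hf x := by
    rw [hL f hf x]
    obtain ⟨C, hC⟩ := hf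
    exact tendsto_transition hR.out Q x hC

theorem isMarkovProcessFrom_run_count (hφ : Function.Surjective φ)
    (hQ : ∀ z, Q (φ z) = p.map fun x => φ (step z x)) {L : (E → ℝ) → E → ℝ}
    (hL : ∀ f : E → ℝ, (∃ C, ∀ y, |f y| ≤ C) → ∀ x,
      L f x = R * (∑' y, (Q x y).toReal * f y - f x)) (z : F) :
    IsMarkovProcessFrom (law (letterLaw R p)) L (φ z)
      (fun (t : ℝ≥0) ω => φ (run step z ω (count t ω))) where
  measurable t x := measurableSet_run_count step z t {z | φ z = x}
  initial := by
    filter_upwards [ae_pos R p] with ω hω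
    rw [NNReal.coe_zero, count_zero hω]; rfl
  right_cts := by
    filter_upwards [ae_unbounded R p] with ω hω t
    exact (eventually_count_right hω t).mono fun s hs => by rw [hs]
  left_lim := by
    filter_upwards [ae_unbounded R p] with ω hω t
    obtain ⟨m, hm⟩ := eventually_count_left hω t
    exact ⟨φ (run step z ω m), hm.mono fun s hs => by rw [hs]⟩
  markov := ⟨transition R Q, isTransitionFunction R p hφ hQ hL,
    fun s t _ hA x y => law_inter_run_count R p hQ z s t hA x y⟩

/-- Two processes driven by the same chain couple if the chain is absorbed by the states in which
they agree. -/
lemma ae_couplingTime_lt_top {ψ : F → E} (z : F)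
    (h : ∀ᵐ ω ∂law (letterLaw R p), ∃ K, ∀ k, K ≤ k → φ (run step z ω k) = ψ (run step z ω k)) :
    ∀ᵐ ω ∂law (letterLaw R p), couplingTime (fun (t : ℝ≥0) ω => φ (run step z ω (count t ω)))
      (fun (t : ℝ≥0) ω => ψ (run step z ω (count t ω))) ω < ⊤ := by
  filter_upwards [h, ae_pos R p, ae_unbounded R p] with ω ⟨K, hK⟩ hpos hunb
  obtain ⟨T, hT, hle⟩ := exists_forall_le_count hpos hunb K
  have hT' : couplingTime (fun (t : ℝ≥0) ω => φ (run step z ω (count t ω)))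
      (fun (t : ℝ≥0) ω => ψ (run step z ω (count t ω))) ω ≤ T :=
    sInf_le ⟨T, ⟨hT, fun t ht => hK _ (hle t ht)⟩, rfl⟩
  exact hT'.trans_lt ENNReal.coe_lt_top

end Uniformization

/-! ### The filtration of an i.i.d. sequence -/

namespace IIDSeq

open ProbabilityTheory

variable {X : Type*} [MeasurableSpace X]

/-- The events that depend on the first `m` terms of a sequence. -/
def past : Filtration ℕ (inferInstance : MeasurableSpace (ℕ → X)) where
  seq m :=
    { MeasurableSet' := fun A => MeasurableSet A ∧
        ∀ ω ω', (∀ i < m, ω i = ω' i) → (ω ∈ A ↔ ω' ∈ A)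
      measurableSet_empty := ⟨MeasurableSet.empty, fun _ _ _ => Iff.rfl⟩
      measurableSet_compl := fun A hA => ⟨hA.1.compl, fun ω ω' h => by
        rw [Set.mem_compl_iff, Set.mem_compl_iff, hA.2 ω ω' h]⟩
      measurableSet_iUnion := fun A hA => ⟨MeasurableSet.iUnion fun i => (hA i).1,
        fun ω ω' h => by
          simp only [Set.mem_iUnion]
          exact exists_congr fun i => (hA i).2 ω ω' h⟩ }
  mono' _ _ hmn _ hA := ⟨hA.1, fun ω ω' h => hA.2 ω ω' fun i hi => h i (hi.trans_le hmn)⟩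
  le' _ _ hA := hA.1

lemma measurable_past {β : Type*} [MeasurableSpace β] {m : ℕ} {f : (ℕ → X) → β} (hf : Measurable f)
    (h : ∀ ω ω', (∀ i < m, ω i = ω' i) → f ω = f ω') : Measurable[past m] f :=
  fun B hB => ⟨hf hB, fun ω ω' h' => by rw [Set.mem_preimage, Set.mem_preimage, h ω ω' h']⟩

lemma indep_past (ν : Measure X) [IsProbabilityMeasure ν] (m : ℕ) :
    Indep (MeasurableSpace.comap (fun ω : ℕ → X => ω m) inferInstance) (past m) (law ν) := by
  refine Indep.symm ((Indep_iff _ _ _).2 ?_)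
  rintro E _ hE ⟨B, hB, rfl⟩
  have h : (fun ω : ℕ → X => ω m) ⁻¹' B = shift m ⁻¹' ((fun ω => ω 0) ⁻¹' B) := rfl
  have hB' : MeasurableSet ((fun ω : ℕ → X => ω 0) ⁻¹' B) := measurable_pi_apply 0 hB
  rw [h, law_inter_shift ν m hE.1 hB' hE.2,
    (measurePreserving_shift ν m).measure_preimage hB'.nullMeasurableSet]

end IIDSeq

/-! ### Recurrence of words and absorption of martingales -/

namespace Uniformization

open IIDSeq ExpClock ProbabilityTheory

section Words

variable {A U : Type*}

/-- Reading the word from the state `a`, the automaton meets a good pair of a state and a letter. -/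
def Hits (δ : A → U → A) (G : A → U → Prop) : A → List U → Prop
  | _, [] => False
  | a, x :: w => G a x ∨ Hits δ G (δ a x) w

lemma Hits.append_right {δ : A → U → A} {G : A → U → Prop} {a : A} {w : List U}
    (h : Hits δ G a w) (w' : List U) : Hits δ G a (w ++ w') := by
  induction w generalizing a with
  | nil => exact h.elim
  | cons x w ih => exact h.imp id ih

lemma Hits.append_left {δ : A → U → A} {G : A → U → Prop} {a : A} (w : List U) {w' : List U}
    (h : Hits δ G (w.foldl δ a) w') : Hits δ G a (w ++ w') := by
  induction w generalizing a with
  | nil => exact h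
  | cons x w ih => exact Or.inr (ih h)

/-- If a good pair can be met from every state, then one word meets good pairs from all states. -/
lemma exists_universal_word [Finite A] (δ : A → U → A) (G : A → U → Prop) (P : U → Prop)
    (h : ∀ a, ∃ w : List U, (∀ x ∈ w, P x) ∧ Hits δ G a w) :
    ∃ w : List U, (∀ x ∈ w, P x) ∧ ∀ a, Hits δ G a w := by
  classical
  have := Fintype.ofFinite A
  suffices ∀ T : Finset A, ∃ w : List U, (∀ x ∈ w, P x) ∧ ∀ a ∈ T, Hits δ G a w by
    obtain ⟨w, hw, hT⟩ := this Finset.univ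
    exact ⟨w, hw, fun a => hT a (Finset.mem_univ a)⟩
  intro T
  induction T using Finset.induction_on with
  | empty => exact ⟨[], by simp, by simp⟩
  | insert a T _ ih =>
    obtain ⟨w, hw, hT⟩ := ih
    -- Ask for a word from the state to which `w` carries the new `a`: appending it serves `a` and
    -- spoils nothing already achieved.
    obtain ⟨w', hw', ha⟩ := h (w.foldl δ a)
    refine ⟨w ++ w', fun x hx => (List.mem_append.1 hx).elim (hw x) (hw' x), fun b hb => ?_⟩
    rcases Finset.mem_insert.1 hb with rfl | hb
    · exact Hits.append_left w ha
    · exact (hT b hb).append_right w'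

lemma exists_good_of_hits {F : Type*} {step : F → U → F} {δ : A → U → A} {G : A → U → Prop}
    {q : F → A} (hq : ∀ z x, q (step z x) = δ (q z) x) (z : F) (ω : ℕ → ℝ × U) (w : List U) (j : ℕ)
    (hw : ∀ i < w.length, w[i]? = some (ω (j + i)).2) (h : Hits δ G (q (run step z ω j)) w) :
    ∃ k, j ≤ k ∧ G (q (run step z ω k)) (ω k).2 := by
  induction w generalizing j with
  | nil => exact h.elim
  | cons x w ih =>
    have hx : x = (ω j).2 := by simpa using hw 0 (by simp)
    rcases h with h | h
    · exact ⟨j, le_rfl, hx ▸ h⟩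
    · rw [hx, ← hq] at h
      obtain ⟨k, hk, hG⟩ := ih (j + 1) (fun i hi => by
        simpa [add_assoc, add_comm 1 i] using hw (i + 1) (by simpa using hi)) h
      exact ⟨k, by omega, hG⟩

variable [MeasurableSpace U] [MeasurableSingletonClass U] [Countable U] (R : ℝ) [hR : Fact (0 < R)]
  (p : PMF U)

/-- If a good pair can be met from every state of a finite automaton, this happens infinitely
often. -/
lemma ae_frequently_good [Finite A] {F : Type*} {step : F → U → F} {δ : A → U → A}
    {G : A → U → Prop} {q : F → A} (hq : ∀ z x, q (step z x) = δ (q z) x)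
    (h : ∀ a, ∃ w : List U, (∀ x ∈ w, p x ≠ 0) ∧ Hits δ G a w) (z : F) :
    ∀ᵐ ω ∂law (letterLaw R p), ∀ K, ∃ k, K ≤ k ∧ G (q (run step z ω k)) (ω k).2 := by
  obtain ⟨w, hw, hG⟩ := exists_universal_word δ G _ h
  have hex : ∀ᵐ ω ∂law (letterLaw R p), ∃ r, ∀ i < w.length,
      ω (r + i) ∈ (Set.univ ×ˢ {x | w[i]? = some x} : Set (ℝ × U)) := by
    refine ae_exists_word _ (D := fun i => Set.univ ×ˢ {x | w[i]? = some x})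
      (fun i => MeasurableSet.univ.prod (Set.to_countable _).measurableSet) _ fun i hi => ?_
    have hs : {x | w[i]? = some x} = {w[i]} := by
      ext x; simp [hi, eq_comm]
    rw [hs]
    exact letterLaw_ne_zero R p (by simp) (hw _ (List.getElem_mem hi))
  filter_upwards [ae_forall_shift _ hex] with ω hω K
  obtain ⟨r, hr⟩ := hω K
  obtain ⟨k, hk, hGk⟩ := exists_good_of_hits hq z ω w (K + r)
    (fun i hi => by simpa [shift, add_assoc] using (hr i hi).2) (hG _)
  exact ⟨k, by omega, hGk⟩

end Words

section Martingale

variable {U F : Type*} [MeasurableSpace U] [MeasurableSingletonClass U] [Countable U] [Countable F]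
  (R : ℝ) [hR : Fact (0 < R)] (p : PMF U) {step : F → U → F}

lemma integral_letter {ξ : U → ℝ} (hξ : ∀ x, |ξ x| ≤ 1) (m : ℕ) :
    Integrable (fun ω => ξ (ω m).2) (law (letterLaw R p)) ∧
      ∫ ω, ξ (ω m).2 ∂law (letterLaw R p) = ∑' x, (p x).toReal * ξ x := by
  have hm : Measurable ξ := Measurable.of_discrete
  have hmp : MeasurePreserving (fun ω : ℕ → ℝ × U => (ω m).2) (law (letterLaw R p)) p.toMeasure :=
    measurePreserving_snd.comp
      (measurePreserving_eval_infinitePi (fun _ : ℕ => letterLaw R p) m)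
  have hint : Integrable ξ p.toMeasure :=
    Integrable.of_bound hm.aestronglyMeasurable 1 (ae_of_all _ hξ)
  refine ⟨hmp.integrable_comp_of_integrable hint, ?_⟩
  have h1 : ∫ ω, ξ (ω m).2 ∂law (letterLaw R p) = ∫ x, ξ x ∂p.toMeasure := by
    rw [← hmp.map_eq, integral_map hmp.measurable.aemeasurable hm.aestronglyMeasurable]
  rw [h1, PMF.integral_eq_tsum _ _ hint]
  rfl

/-- A martingale with values in the natural numbers that keeps moving while it is not zero reaches
zero. -/
lemma ae_exists_eq_zero {M : F → ℕ} {a : F → ℤ} {ξ : U → ℤ} (ha : ∀ z, |a z| ≤ 1)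
    (hξ : ∀ x, |ξ x| ≤ 1) (h0 : ∑' x, (p x).toReal * (ξ x : ℝ) = 0) (z : F)
    (hM : ∀ ω k, (M (run step z ω (k + 1)) : ℤ) =
      M (run step z ω k) + a (run step z ω k) * ξ (ω k).2)
    (hio : ∀ᵐ ω ∂law (letterLaw R p), ∀ K, ∃ k, K ≤ k ∧
      (M (run step z ω k) ≠ 0 → M (run step z ω (k + 1)) ≠ M (run step z ω k))) :
    ∀ᵐ ω ∂law (letterLaw R p), ∃ k, M (run step z ω k) = 0 := by
  let _ : MeasurableSpace F := ⊤
  have : DiscreteMeasurableSpace F := ⟨fun _ => trivial⟩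
  set N : ℕ → (ℕ → ℝ × U) → ℝ := fun k ω => M (run step z ω k) with hN
  have hξ' : ∀ x, |(ξ x : ℝ)| ≤ 1 := fun x => by exact_mod_cast hξ x
  have ha' : ∀ z, |(a z : ℝ)| ≤ 1 := fun z => by exact_mod_cast ha z
  have hrun : ∀ {β : Type} [MeasurableSpace β] (g : F → β) (k : ℕ),
      Measurable[past k] fun ω : ℕ → ℝ × U => g (run step z ω k) := fun g k =>
    measurable_past ((Measurable.of_discrete (f := g)).comp (measurable_run step z k))
      fun ω ω' h => by rw [run_congr step h z le_rfl]
  have hbound : ∀ k ω, |N k ω| ≤ M z + k := by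
    intro k ω
    induction k with
    | zero => simp [hN, run]
    | succ k ih =>
      have h1 : N (k + 1) ω = N k ω + a (run step z ω k) * ξ (ω k).2 := by
        simp only [hN]; exact_mod_cast hM ω k
      have h2 : |(a (run step z ω k) : ℝ) * ξ (ω k).2| ≤ 1 := by
        rw [abs_mul]
        exact mul_le_one₀ (ha' _) (abs_nonneg _) (hξ' _)
      rw [h1]
      push_cast
      linarith [abs_add_le (N k ω) (a (run step z ω k) * ξ (ω k).2)]
  have hadp : StronglyAdapted past N := fun k => (hrun (fun z => (M z : ℝ)) k).stronglyMeasurable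
  have hint : ∀ k, Integrable (N k) (law (letterLaw R p)) := fun k =>
    Integrable.of_bound ((hadp k).mono (past.le k)).aestronglyMeasurable _ (ae_of_all _ (hbound k))
  have hmart : Martingale N past (law (letterLaw R p)) := by
    refine martingale_of_condExp_sub_eq_zero_nat hadp hint fun k => ?_
    have h1 : N (k + 1) - N k =
        (fun ω => (a (run step z ω k) : ℝ)) * fun ω => (ξ (ω k).2 : ℝ) := by
      funext ω
      have : N (k + 1) ω = N k ω + a (run step z ω k) * ξ (ω k).2 := by
        simp only [hN]; exact_mod_cast hM ω k
      simp [this]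
    obtain ⟨hi, hE⟩ := integral_letter R p (ξ := fun x => (ξ x : ℝ)) hξ' k
    have hsm := (hrun (fun z => (a z : ℝ)) k).stronglyMeasurable
    have hprod : Integrable ((fun ω => (a (run step z ω k) : ℝ)) * fun ω => (ξ (ω k).2 : ℝ))
        (law (letterLaw R p)) :=
      hi.bdd_mul (c := 1) (hsm.mono (past.le k)).aestronglyMeasurable
        (ae_of_all _ fun ω => ha' _)
    have hle : MeasurableSpace.comap (fun ω : ℕ → ℝ × U => ω k) inferInstance ≤
        (inferInstance : MeasurableSpace (ℕ → ℝ × U)) := (measurable_pi_apply k).comap_le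
    have hξm : Measurable fun w : ℝ × U => (ξ w.2 : ℝ) :=
      (Measurable.of_discrete (f := fun x : U => (ξ x : ℝ))).comp measurable_snd
    have hc := condExp_indep_eq (f := fun ω : ℕ → ℝ × U => (ξ (ω k).2 : ℝ)) hle (past.le k)
      (hξm.comp (comap_measurable _)).stronglyMeasurable (indep_past (letterLaw R p) k)
    rw [h1]
    filter_upwards [condExp_mul_of_stronglyMeasurable_left hsm hprod hi, hc] with ω h2 h3
    rw [h2, Pi.mul_apply, h3, hE, h0, mul_zero]; rfl
  -- By nonnegativity the norm in L¹ is the expectation, which a martingale keeps constant.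
  have hL1 : ∀ k, eLpNorm (N k) 1 (law (letterLaw R p)) ≤ ((M z : ℝ≥0) : ℝ≥0∞) := by
    intro k
    have h1 : ∫ ω, N k ω ∂law (letterLaw R p) = M z := by
      have := hmart.setIntegral_eq (Nat.zero_le k) (s := Set.univ) MeasurableSet.univ
      simpa [hN, run] using this.symm
    rw [eLpNorm_one_eq_lintegral_enorm]
    have h2 : ∫⁻ ω, ‖N k ω‖ₑ ∂law (letterLaw R p) =
        ∫⁻ ω, ENNReal.ofReal (N k ω) ∂law (letterLaw R p) :=
      lintegral_congr fun ω => Real.enorm_of_nonneg (Nat.cast_nonneg _)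
    rw [h2, ← ofReal_integral_eq_lintegral_ofReal (hint k)
      (ae_of_all _ fun ω => Nat.cast_nonneg _), h1]
    simp
  filter_upwards [hmart.submartingale.exists_ae_tendsto_of_bdd hL1, hio] with ω ⟨c, hc⟩ hω
  -- A convergent sequence of integers eventually has increments smaller than 1, hence zero; this
  -- contradicts moving infinitely often while nonzero.
  by_contra! hne
  have h1 : ∀ᶠ k in atTop, |N (k + 1) ω - N k ω| < 1 := by
    have := ((hc.comp (tendsto_add_atTop_nat 1)).sub hc).abs
    rw [sub_self, abs_zero] at this
    exact this.eventually_lt_const one_pos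
  obtain ⟨K, hK⟩ := eventually_atTop.1 h1
  obtain ⟨k, hk, hmove⟩ := hω K
  refine hmove (hne k) ?_
  have h2 := hK k hk
  simp only [hN] at h2
  have h3 : |(M (run step z ω (k + 1)) : ℤ) - M (run step z ω k)| < 1 := by exact_mod_cast h2
  have h4 := Int.abs_lt_one_iff.1 h3
  omega

end Martingale

end Uniformization

/-! ### The coupling of two particles -/

namespace LayeredWalk

open IIDSeq Uniformization

/-- The events of the clocks: a jump of some kind, or a change of layer. -/
abbrev Clock (J S : Type u) : Type u := J ⊕ (S × S)

/-- A particle whose jumps of each kind are counted, together with its layer. -/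
abbrev Lift (J S : Type u) : Type u := (J → ℤ) × S

/-- A letter: nothing, or an event for one of `n` pairs of particles, with a coin. -/
abbrev Letter (n : ℕ) (J S : Type u) : Type u := Option (Fin n × Clock J S × Bool)

/-- The assumptions on the distribution of the letters. -/
structure IsFair {n : ℕ} {J S : Type u} (p : PMF (Letter n J S)) : Prop where
  none_ne_zero : p none ≠ 0
  jump_ne_zero : ∀ i j b, p (some (i, Sum.inl j, b)) ≠ 0
  jump_symm : ∀ i j, p (some (i, Sum.inl j, true)) = p (some (i, Sum.inl j, false))
  irreducible : ∀ i (σ σ' : S), Relation.ReflTransGen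
    (fun a b => p (some (i, Sum.inr (a, b), true)) ≠ 0) σ σ'

variable {J S : Type u} [DecidableEq J] [DecidableEq S]

/-- The effect of an event on a particle; jumps of kind `j` happen in the layer `lay j` only. -/
def act (lay : J → S) : Clock J S → Lift J S → Lift J S
  | Sum.inl j, v => if lay j = v.2 then (v.1 + Pi.single j 1, v.2) else v
  | Sum.inr s, v => if s.1 = v.2 then (v.1, s.2) else v

/-- Whether two particles react to different coin tosses. -/
def uncoupled : Clock J S → Lift J S → Lift J S → Bool
  | Sum.inl j, v, v' => decide (v.1 j ≠ v'.1 j)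
  | Sum.inr _, v, v' => decide (v.2 ≠ v'.2)

/-- The coupled motion: the coin decides whether the first particle reacts to the event. The second
particle follows the same coin or the opposite one. -/
def pairStep (lay : J → S) (γ : Clock J S) (b : Bool) (q : Lift J S × Lift J S) :
    Lift J S × Lift J S :=
  (if b then act lay γ q.1 else q.1, if xor b (uncoupled γ q.1 q.2) then act lay γ q.2 else q.2)

variable {n : ℕ}

/-- The coupled motion of `n` pairs of particles. -/
def pairsStep (lay : J → S) (z : Fin n → Lift J S × Lift J S) :
    Letter n J S → Fin n → Lift J S × Lift J S
  | none => z
  | some (i, γ, b) => Function.update z i (pairStep lay γ b (z i))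

/-- The layers of a pair of particles. -/
def layers (q : Lift J S × Lift J S) : S × S := (q.1.2, q.2.2)

/-- The motion of the layers of the pair `i`. -/
def layersStep (i : Fin n) (s : S × S) : Letter n J S → S × S
  | some (k, Sum.inr r, b) =>
    if k = i then (if b ∧ r.1 = s.1 then r.2 else s.1,
      if xor b (decide (s.1 ≠ s.2)) ∧ r.1 = s.2 then r.2 else s.2) else s
  | _ => s

lemma layers_pairsStep (lay : J → S) (i : Fin n) (z : Fin n → Lift J S × Lift J S)
    (x : Letter n J S) : layers (pairsStep lay z x i) = layersStep i (layers (z i)) x := by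
  rcases x with _ | ⟨k, j | r, b⟩
  · rfl
  · by_cases hk : k = i
    · subst hk
      simp only [pairsStep, Function.update_self, layersStep, layers, pairStep, act]
      split_ifs <;> rfl
    · simp [pairsStep, layersStep, Function.update_of_ne (Ne.symm hk)]
  · by_cases hk : k = i
    · subst hk
      simp only [pairsStep, Function.update_self, layersStep, layers, pairStep, act, uncoupled,
        if_true]
      refine Prod.ext ?_ ?_
      · cases b <;> simp [apply_ite Prod.snd]
      · by_cases hs : (z k).1.2 = (z k).2.2 <;> cases b <;> simp [hs, apply_ite Prod.snd]
    · simp [pairsStep, layersStep, Function.update_of_ne (Ne.symm hk), hk]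

/-- The difference of the numbers of jumps of kind `j` in a pair of particles. -/
def gap (j : J) (q : Lift J S × Lift J S) : ℤ := q.1.1 j - q.2.1 j

/-- The coin toss, if the letter asks the pair `i` for a jump of kind `j`. -/
def toss (i : Fin n) (j : J) : Letter n J S → ℤ
  | some (k, Sum.inl l, b) => if k = i ∧ l = j then (if b then 1 else -1) else 0
  | _ => 0

lemma toss_abs_le (i : Fin n) (j : J) (x : Letter n J S) : |toss i j x| ≤ 1 := by
  rcases x with _ | ⟨k, l | r, b⟩ <;> simp only [toss] <;> (try split_ifs) <;> simp

/-- The direction in which the gap reacts to the coin. -/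
def drift (lay : J → S) (j : J) (q : Lift J S × Lift J S) : ℤ :=
  if lay j = q.1.2 then (gap j q).sign else 0

lemma drift_abs_le (lay : J → S) (j : J) (q : Lift J S × Lift J S) : |drift lay j q| ≤ 1 := by
  rw [drift]
  split_ifs
  · rcases lt_trichotomy (gap j q) 0 with h | h | h
    · simp [Int.sign_eq_neg_one_of_neg h]
    · simp [h]
    · simp [Int.sign_eq_one_of_pos h]
  · simp

/-- In a common layer both particles can make the jump, or neither can. If their counts differ,
opposite coins let exactly one of them jump, moving the gap by the toss; the gap is nonzero, so its
absolute value moves by the sign times the toss. If the counts agree, they share the coin and the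
gap stays 0. Equality of the layers is essential. -/
lemma natAbs_gap_pairsStep (lay : J → S) (i : Fin n) (j : J) (z : Fin n → Lift J S × Lift J S)
    (hz : (z i).1.2 = (z i).2.2) (x : Letter n J S) :
    ((gap j (pairsStep lay z x i)).natAbs : ℤ) =
      (gap j (z i)).natAbs + drift lay j (z i) * toss i j x := by
  rcases x with _ | ⟨k, l | r, b⟩
  · simp [pairsStep, toss]
  · by_cases hk : k = i
    · subst hk
      simp only [pairsStep, Function.update_self, toss, pairStep, act, uncoupled, drift, ← hz]
      by_cases hl : l = j
      · subst hl
        by_cases hlay : lay l = (z k).1.2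
        · simp only [hlay, if_true, and_self]
          by_cases hg : (z k).1.1 l = (z k).2.1 l
          · cases b <;> simp [gap, hg]
          · have hg' : gap l (z k) ≠ 0 := sub_ne_zero.2 hg
            have hdec : decide ((z k).1.1 l ≠ (z k).2.1 l) = true := by simpa using hg
            rw [hdec]
            rcases lt_or_gt_of_ne hg' with h | h
            · rw [Int.sign_eq_neg_one_of_neg h]
              unfold gap at h ⊢
              cases b <;> simp [-Nat.cast_natAbs] <;> omega
            · rw [Int.sign_eq_one_of_pos h]
              unfold gap at h ⊢
              cases b <;> simp [-Nat.cast_natAbs] <;> omega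
        · simp only [hlay, if_false, zero_mul, add_zero]
          split_ifs <;> rfl
      · simp only [hl, and_false, if_false, mul_zero, add_zero]
        have hne : j ≠ l := fun h => hl h.symm
        congr 2
        unfold gap
        split_ifs <;> simp [hne]
    · simp [pairsStep, toss, Function.update_of_ne (Ne.symm hk), hk]
  · by_cases hk : k = i
    · subst hk
      simp only [pairsStep, Function.update_self, toss, mul_zero, add_zero, pairStep, act]
      congr 2
      unfold gap
      split_ifs <;> rfl
    · simp [pairsStep, toss, Function.update_of_ne (Ne.symm hk)]

lemma layers_eq_run {lay : J → S} {i : Fin n} {z : Fin n → Lift J S × Lift J S}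
    (hz : (z i).1.2 = (z i).2.2) (ω : ℕ → ℝ × Letter n J S) (k : ℕ) :
    (run (pairsStep lay) z ω k i).1.2 = (run (pairsStep lay) z ω k i).2.2 := by
  induction k with
  | zero => exact hz
  | succ k ih =>
    have h := layers_pairsStep lay i (run (pairsStep lay) z ω k) (ω k).2
    set s := layers (run (pairsStep lay) z ω k i) with hs
    have hs' : s.1 = s.2 := ih
    have h1 : (layersStep i s (ω k).2).1 = (layersStep i s (ω k).2).2 := by
      rcases (ω k).2 with _ | ⟨l, j | r, b⟩
      · exact hs'
      · exact hs'
      · simp only [layersStep]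
        split_ifs <;> simp_all
    rw [← h] at h1
    exact h1

/-- Zero is absorbing because the drift carries the sign of the gap as a factor. -/
lemma gap_eq_zero_of_le {lay : J → S} {i : Fin n} {j : J} {z : Fin n → Lift J S × Lift J S}
    (hz : (z i).1.2 = (z i).2.2) (ω : ℕ → ℝ × Letter n J S) {k l : ℕ} (hkl : k ≤ l)
    (hk : gap j (run (pairsStep lay) z ω k i) = 0) :
    gap j (run (pairsStep lay) z ω l i) = 0 := by
  induction l, hkl using Nat.le_induction with
  | base => exact hk
  | succ l _ ih =>
    have h := natAbs_gap_pairsStep lay i j _ (layers_eq_run (lay := lay) hz ω l) (ω l).2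
    rw [drift, ih] at h
    simpa [run] using h

variable {p : PMF (Letter n J S)} (lay : J → S)

/-- While the layers differ, a layer event with coin `true` moves only the first particle, so it can
be led along an irreducibility path to the layer of the second. A good pair includes a letter,
whence the idle letter at the end. -/
lemma exists_word_layers_eq (hp : IsFair p) (i : Fin n) (s : S × S) :
    ∃ w : List (Letter n J S), (∀ x ∈ w, p x ≠ 0) ∧
      Hits (layersStep i) (fun s _ => s.1 = s.2) s w := by
  obtain ⟨σ, σ'⟩ := s
  induction hp.irreducible i σ σ' using Relation.ReflTransGen.head_induction_on with
  | refl => exact ⟨[none], by simpa using hp.none_ne_zero, Or.inl rfl⟩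
  | @head σ τ h _ ih =>
    obtain ⟨w, hw, hh⟩ := ih
    refine ⟨some (i, Sum.inr (σ, τ), true) :: w, ?_, ?_⟩
    · simpa using ⟨h, hw⟩
    · by_cases hσ : σ = σ'
      · exact Or.inl hσ
      · refine Or.inr ?_
        simpa [layersStep, hσ] using hh

/-- From equal layers, both particles are led together to the layer where jump `j` is possible. From
different layers the goodness condition is vacuous: the lemma serves only runs on the diagonal, but
the automaton argument requires a word from every state. -/
lemma exists_word_jump (hp : IsFair p) (i : Fin n) (j : J) (s : S × S) :
    ∃ w : List (Letter n J S), (∀ x ∈ w, p x ≠ 0) ∧ Hits (layersStep i)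
      (fun s x => s.1 = s.2 → lay j = s.1 ∧ x = some (i, Sum.inl j, true)) s w := by
  obtain ⟨σ, σ'⟩ := s
  by_cases hσ : σ = σ'
  · subst hσ
    induction hp.irreducible i σ (lay j) using Relation.ReflTransGen.head_induction_on with
    | refl =>
      exact ⟨[some (i, Sum.inl j, true)], by simpa using hp.jump_ne_zero i j true,
        Or.inl fun _ => ⟨rfl, rfl⟩⟩
    | @head σ τ h _ ih =>
      obtain ⟨w, hw, hh⟩ := ih
      refine ⟨some (i, Sum.inr (σ, τ), true) :: w, ?_, Or.inr ?_⟩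
      · simpa using ⟨h, hw⟩
      · simpa [layersStep] using hh
  · exact ⟨[none], by simpa using hp.none_ne_zero, Or.inl fun h => absurd h hσ⟩

lemma tsum_toss (hp : IsFair p) (i : Fin n) (j : J) :
    ∑' x, (p x).toReal * (toss i j x : ℝ) = 0 := by
  classical
  have hne : (some (i, Sum.inl j, true) : Letter n J S) ≠ some (i, Sum.inl j, false) := by simp
  rw [tsum_eq_sum (s := {some (i, Sum.inl j, true), some (i, Sum.inl j, false)}),
    Finset.sum_pair hne]
  · simp [toss, hp.jump_symm]
  · intro x hx
    have : toss i j x = 0 := by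
      rcases x with _ | ⟨k, l | r, b⟩
      · rfl
      · simp only [toss]
        split_ifs with h1 h2
        · obtain ⟨rfl, rfl⟩ := h1
          exact absurd (by simp [h2]) hx
        · obtain ⟨rfl, rfl⟩ := h1
          exact absurd (by simp [Bool.eq_false_iff.2 h2]) hx
        · rfl
      · rfl
    simp [this]

variable [Finite S] [Finite J] [MeasurableSpace (Letter n J S)]
  [MeasurableSingletonClass (Letter n J S)]
  (R : ℝ) [hR : Fact (0 < R)]

lemma ae_exists_gap_eq_zero (hp : IsFair p) (i : Fin n) (j : J) (z : Fin n → Lift J S × Lift J S)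
    (hz : (z i).1.2 = (z i).2.2) :
    ∀ᵐ ω ∂law (letterLaw R p), ∃ k, gap j (run (pairsStep lay) z ω k i) = 0 := by
  have hfreq := ae_frequently_good R p (step := pairsStep lay) (q := fun z => layers (z i))
    (fun z x => layers_pairsStep lay i z x) (exists_word_jump lay hp i j) z
  have hM : ∀ (ω : ℕ → ℝ × Letter n J S) k,
      ((gap j (run (pairsStep lay) z ω (k + 1) i)).natAbs : ℤ) =
        (gap j (run (pairsStep lay) z ω k i)).natAbs +
          drift lay j (run (pairsStep lay) z ω k i) * toss i j (ω k).2 := fun ω k =>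
    natAbs_gap_pairsStep lay i j _ (layers_eq_run hz ω k) _
  have := ae_exists_eq_zero R p (step := pairsStep lay) (M := fun z => (gap j (z i)).natAbs)
    (a := fun z => drift lay j (z i)) (ξ := toss i j) (fun z => drift_abs_le lay j _)
    (toss_abs_le i j) (tsum_toss hp i j) z hM ?_
  · filter_upwards [this] with ω ⟨k, hk⟩
    exact ⟨k, Int.natAbs_eq_zero.1 hk⟩
  · filter_upwards [hfreq] with ω hω K
    obtain ⟨k, hk, hG⟩ := hω K
    refine ⟨k, hk, fun h0 heq => ?_⟩
    obtain ⟨h1, h2⟩ := hG (layers_eq_run hz ω k)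
    have h3 := hM ω k
    rw [heq, h2, drift, if_pos (show lay j = (run (pairsStep lay) z ω k i).1.2 from h1)] at h3
    have h4 : (gap j (run (pairsStep lay) z ω k i)).sign = 0 := by simpa [toss] using h3
    exact h0 (Int.natAbs_eq_zero.2 (Int.sign_eq_zero_iff_zero.1 h4))

/-- Almost surely the particles of a pair are together from some time on. -/
theorem ae_pair_eventually_eq (hp : IsFair p) (z : Fin n → Lift J S × Lift J S) (i : Fin n) :
    ∀ᵐ ω ∂law (letterLaw R p), ∃ K, ∀ k, K ≤ k →
      (run (pairsStep lay) z ω k i).1 = (run (pairsStep lay) z ω k i).2 := by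
  have h1 := ae_frequently_good R p (step := pairsStep lay) (q := fun z => layers (z i))
    (fun z x => layers_pairsStep lay i z x) (exists_word_layers_eq hp i) z
  -- There are countably many starting states, so one null set serves them all, and the statement
  -- may be applied to the random state in which the layers meet.
  have h2 : ∀ᵐ ω ∂law (letterLaw R p), ∀ (z : Fin n → Lift J S × Lift J S) (j : J),
      (z i).1.2 = (z i).2.2 → ∃ k, gap j (run (pairsStep lay) z ω k i) = 0 := by
    refine ae_all_iff.2 fun z => ae_all_iff.2 fun j => ?_
    by_cases hz : (z i).1.2 = (z i).2.2
    · exact (ae_exists_gap_eq_zero lay R hp i j z hz).mono fun ω h _ => h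
    · exact ae_of_all _ fun ω h => absurd h hz
  filter_upwards [h1, ae_forall_shift _ h2] with ω hω1 hω2
  obtain ⟨m, -, hm⟩ := hω1 0
  set z' := run (pairsStep lay) z ω m
  have hz' : (z' i).1.2 = (z' i).2.2 := hm
  choose k hk using fun j => hω2 m z' j hz'
  obtain ⟨K, hK⟩ := (Set.finite_range k).bddAbove
  refine ⟨m + K, fun l hl => ?_⟩
  obtain ⟨r, rfl⟩ := Nat.exists_eq_add_of_le hl
  rw [add_assoc, run_add]
  refine Prod.ext (funext fun j => ?_) (layers_eq_run hz' _ _)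
  exact sub_eq_zero.1 (gap_eq_zero_of_le hz' _ ((hK ⟨j, rfl⟩).trans (Nat.le_add_right K r)) (hk j))

theorem ae_pairs_eventually_eq (hp : IsFair p) (z : Fin n → Lift J S × Lift J S) :
    ∀ᵐ ω ∂law (letterLaw R p), ∃ K, ∀ k, K ≤ k → ∀ i,
      (run (pairsStep lay) z ω k i).1 = (run (pairsStep lay) z ω k i).2 := by
  filter_upwards [ae_all_iff.2 (ae_pair_eventually_eq lay R hp z)] with ω hω
  choose K hK using hω
  obtain ⟨N, hN⟩ := (Set.finite_range K).bddAbove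
  exact ⟨N, fun k hk i => hK i k ((hN ⟨i, rfl⟩).trans hk)⟩

end LayeredWalk

/-! ### Couplings from chains of letters -/

namespace Uniformization

open IIDSeq ExpClock ProbabilityTheory

lemma tsum_map_toReal {U E : Type*} [Fintype U] (p : PMF U) (h : U → E) {f : E → ℝ}
    (hf : ∃ C, ∀ y, |f y| ≤ C) :
    ∑' y, (p.map h y).toReal * f y = ∑ x, (p x).toReal * f (h x) := by
  classical
  let _ : MeasurableSpace U := ⊤
  let _ : MeasurableSpace E := ⊤
  have : DiscreteMeasurableSpace U := ⟨fun _ => trivial⟩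
  have : DiscreteMeasurableSpace E := ⟨fun _ => trivial⟩
  obtain ⟨C, hC⟩ := hf
  have hterm : ∀ y, (p.map h y).toReal = ∑ x, if y = h x then (p x).toReal else 0 := by
    intro y
    rw [PMF.map_apply, tsum_fintype, ENNReal.toReal_sum]
    · exact Finset.sum_congr rfl fun x _ => by split_ifs <;> simp
    · intro x _
      split_ifs
      · exact p.apply_ne_top x
      · simp
  have hs : HasSum (fun y => ∑ x, if y = h x then (p x).toReal * f (h x) else 0)
      (∑ x, (p x).toReal * f (h x)) :=
    hasSum_sum fun x _ => hasSum_ite_eq (h x) ((p x).toReal * f (h x))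
  rw [← hs.tsum_eq]
  refine tsum_congr fun y => ?_
  rw [hterm, Finset.sum_mul]
  refine Finset.sum_congr rfl fun x _ => ?_
  split_ifs with hy
  · rw [hy]
  · rw [zero_mul]

variable {U E : Type u} {F : Type*} [Fintype U] (R : ℝ) [hR : Fact (0 < R)] (p : PMF U)
  {step : F → U → F} {L : (E → ℝ) → E → ℝ}

/-- If the generator of the chain at `φ z` depends on `φ z` only, then the chain is Markov. -/
lemma exists_kernel {φ : F → E} (hφ : Function.Surjective φ)
    (hL : ∀ z f, R * ∑ x, (p x).toReal * (f (φ (step z x)) - f (φ z)) = L f (φ z)) :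
    ∃ Q : E → PMF E, (∀ z, Q (φ z) = p.map fun x => φ (step z x)) ∧
      ∀ f : E → ℝ, (∃ C, ∀ y, |f y| ≤ C) → ∀ x,
        L f x = R * (∑' y, (Q x y).toReal * f y - f x) := by
  classical
  have hsum : ∑ x, (p x).toReal = 1 := by
    rw [← tsum_fintype (L := SummationFilter.unconditional U), tsum_toReal]
  have key : ∀ z f, R * (∑ x, (p x).toReal * f (φ (step z x)) - f (φ z)) = L f (φ z) := by
    intro z f
    rw [← hL z f]
    simp only [mul_sub, Finset.sum_sub_distrib, ← Finset.sum_mul, hsum, one_mul]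
  have hind : ∀ (q : PMF E) y, ∑' y', (q y').toReal * (if y' = y then 1 else 0) =
      (q y).toReal := by
    intro q y
    rw [tsum_eq_single y fun y' hy' => by simp [hy']]
    simp
  refine ⟨fun ξ => p.map fun x => φ (step (Function.surjInv hφ ξ) x), fun z => ?_, ?_⟩
  · refine PMF.ext fun y => ?_
    rw [← ENNReal.toReal_eq_toReal_iff' (PMF.apply_ne_top _ _) (PMF.apply_ne_top _ _),
      ← hind, ← hind]
    have hb : ∃ C : ℝ, ∀ y' : E, |(if y' = y then (1 : ℝ) else 0)| ≤ C :=
      ⟨1, fun y' => by split_ifs <;> simp⟩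
    rw [tsum_map_toReal p _ hb, tsum_map_toReal p _ hb]
    -- Applied to indicators, the generator determines the one-step law; hence the law is the same
    -- for all states in a fibre of `φ`.
    have h1 := key (Function.surjInv hφ (φ z)) fun y' => if y' = y then 1 else 0
    have h2 := key z fun y' => if y' = y then 1 else 0
    rw [Function.surjInv_eq hφ] at h1
    have h3 := mul_left_cancel₀ hR.out.ne' (h1.trans h2.symm)
    exact sub_left_injective h3
  · intro f hf x
    rw [tsum_map_toReal p _ hf]
    have := key (Function.surjInv hφ x) f
    rw [Function.surjInv_eq hφ] at this
    exact this.symm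

theorem hasSuccessfulCoupling_of_chain [Countable F] {φ ψ : F → E}
    (hsurj : ∀ x x', ∃ z, φ z = x ∧ ψ z = x')
    (hφ : ∀ z f, R * ∑ x, (p x).toReal * (f (φ (step z x)) - f (φ z)) = L f (φ z))
    (hψ : ∀ z f, R * ∑ x, (p x).toReal * (f (ψ (step z x)) - f (ψ z)) = L f (ψ z))
    (habs : ∀ [MeasurableSpace U] [MeasurableSingletonClass U] (z : F),
      ∀ᵐ ω ∂law (letterLaw R p), ∃ K, ∀ k, K ≤ k → φ (run step z ω k) = ψ (run step z ω k)) :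
    HasSuccessfulCoupling L := by
  intro x x'
  let _ : MeasurableSpace U := ⊤
  have : DiscreteMeasurableSpace U := ⟨fun _ => trivial⟩
  obtain ⟨Q, hQ, hQL⟩ := exists_kernel R p (fun x => (hsurj x x).imp fun _ h => h.1) hφ
  obtain ⟨Q', hQ', hQL'⟩ := exists_kernel R p (fun x => (hsurj x x).imp fun _ h => h.2) hψ
  obtain ⟨z, rfl, rfl⟩ := hsurj x x'
  exact ⟨ℕ → ℝ × U, inferInstance, law (letterLaw R p),
    fun (t : ℝ≥0) ω => φ (run step z ω (count t ω)),
    fun (t : ℝ≥0) ω => ψ (run step z ω (count t ω)), inferInstance,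
    isMarkovProcessFrom_run_count R p (fun x => (hsurj x x).imp fun _ h => h.1) hQ hQL z,
    isMarkovProcessFrom_run_count R p (fun x => (hsurj x x).imp fun _ h => h.2) hQ' hQL' z,
    ae_couplingTime_lt_top R p z (habs z)⟩

end Uniformization

/-! ### Configurations of labelled particles -/

namespace Config

variable {V : Type u} {n : ℕ}

/-- The configuration of `n` labelled particles. -/
def ofPositions (v : Fin n → V) : Config V n :=
  ⟨∑ i, Finsupp.single (v i) 1, by simp [map_sum]⟩

lemma exists_ofPositions (ξ : Config V n) : ∃ v, ofPositions v = ξ := by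
  obtain ⟨ξ, hξ⟩ := ξ
  suffices ∃ v : Fin n → V, ∑ i, Finsupp.single (v i) 1 = ξ from
    this.imp fun v hv => Subtype.ext hv
  induction n generalizing ξ with
  | zero => exact ⟨Fin.elim0, by simpa using ((Finsupp.degree_eq_zero_iff ξ).1 hξ).symm⟩
  | succ n ih =>
    have h0 : ξ ≠ 0 := by rintro rfl; simp at hξ
    obtain ⟨w, hw⟩ := Finsupp.ne_iff.1 h0
    have hle : Finsupp.single w 1 ≤ ξ := by
      rw [Finsupp.single_le_iff]; exact Nat.one_le_iff_ne_zero.2 hw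
    have hadd := tsub_add_cancel_of_le hle
    have hdeg : (ξ - Finsupp.single w 1).degree = n := by
      have := congrArg Finsupp.degree hadd
      rw [map_add, Finsupp.degree_single, hξ] at this
      omega
    obtain ⟨v, hv⟩ := ih _ hdeg
    refine ⟨Fin.cons w v, ?_⟩
    rw [Fin.sum_univ_succ]
    simp only [Fin.cons_zero, Fin.cons_succ]
    rw [hv, add_comm, hadd]

lemma ofPositions_eq (v : Fin n → V) (i : Fin n) (w : V) :
    (ofPositions (Function.update v i w)).1 =
      Finsupp.single w 1 + ∑ k ∈ Finset.univ \ {i}, Finsupp.single (v k) 1 := by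
  classical
  rw [← Finset.sum_update_of_mem (Finset.mem_univ i) (fun k => Finsupp.single (v k) (1 : ℕ))]
  change ∑ k, Finsupp.single (Function.update v i w k) 1 = _
  refine Finset.sum_congr rfl fun k _ => ?_
  by_cases hk : k = i
  · subst hk; simp
  · simp [hk]

lemma move_ofPositions (v : Fin n → V) (i : Fin n) (w : V) :
    (ofPositions v).move (v i) w = ofPositions (Function.update v i w) := by
  have h1 : (ofPositions v).1 = Finsupp.single (v i) 1 +
      ∑ k ∈ Finset.univ \ {i}, Finsupp.single (v k) 1 := by
    rw [← ofPositions_eq, Function.update_eq_self]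
  have h2 : (ofPositions v).1 (v i) ≠ 0 := by
    rw [h1, Finsupp.add_apply, Finsupp.single_eq_same]; omega
  refine (dif_pos h2 : (ofPositions v).move (v i) w = _).trans (Subtype.ext ?_)
  change (ofPositions v).1 - Finsupp.single (v i) 1 + Finsupp.single w 1 = _
  rw [ofPositions_eq, h1, add_tsub_cancel_left, add_comm]

lemma move_self (ξ : Config V n) {v : V} (hv : v ∈ ξ.1.support) : ξ.move v v = ξ := by
  have h : ξ.1 v ≠ 0 := Finsupp.mem_support_iff.1 hv
  refine (dif_pos h : ξ.move v v = _).trans (Subtype.ext (tsub_add_cancel_of_le ?_))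
  rw [Finsupp.single_le_iff]; omega

lemma sum_support_ofPositions (v : Fin n → V) (h : V → ℝ) :
    ∑ x ∈ (ofPositions v).1.support, ((ofPositions v).1 x : ℝ) * h x = ∑ i, h (v i) := by
  change (∑ i, Finsupp.single (v i) 1 : V →₀ ℕ).sum (fun x k => (k : ℝ) * h x) = _
  rw [← Finsupp.sum_finsetSum_index (fun x => by simp) fun x a b => by push_cast; ring]
  exact Finset.sum_congr rfl fun i _ => by rw [Finsupp.sum_single_index] <;> simp

/-- The occupation number of a site counts the labels sitting there, so summing over sites with that
factor is summing over labels. The rate identity `hp` need only hold for `g` vanishing at `v`, since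
moving a particle to its own site changes nothing. -/
lemma indepGenerator_ofPositions {Γ : Type*} [Fintype Γ] {α : ℝ} {p : V → V → ℝ} {ρ : Γ → ℝ}
    {a : Γ → V → V}
    (hp : ∀ v (g : V → ℝ), g v = 0 → ∑' w, p v w * g w = ∑ γ, ρ γ * g (a γ v))
    (f : Config V n → ℝ) (v : Fin n → V) :
    indepGenerator α p f (ofPositions v) = ∑ i, ∑ γ, α * ρ γ *
      (f (ofPositions (Function.update v i (a γ (v i)))) - f (ofPositions v)) := by
  rw [indepGenerator]
  have h1 : ∀ x ∈ (ofPositions v).1.support,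
      ∑' w, p x w * (((ofPositions v).1 x : ℝ) * α) *
        (f ((ofPositions v).move x w) - f (ofPositions v)) =
      ((ofPositions v).1 x : ℝ) * ∑ γ, α * ρ γ *
        (f ((ofPositions v).move x (a γ x)) - f (ofPositions v)) := by
    intro x hx
    have := hp x (fun w => (((ofPositions v).1 x : ℝ) * α) *
        (f ((ofPositions v).move x w) - f (ofPositions v))) (by simp [move_self _ hx])
    simp only [mul_assoc] at this ⊢
    rw [this, Finset.mul_sum]
    exact Finset.sum_congr rfl fun γ _ => by ring
  rw [Finset.sum_congr rfl h1, sum_support_ofPositions v fun x => ∑ γ, α * ρ γ *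
        (f ((ofPositions v).move x (a γ x)) - f (ofPositions v))]
  simp only [move_ofPositions]

end Config

/-! ### From lifted pairs to configurations on the lattice -/

namespace LayeredWalk

open IIDSeq Uniformization

section Fair

variable {n : ℕ} {J S : Type u} [Fintype J] [Fintype S]

/-- The rates of the letters. -/
def weight (α : ℝ) (ρ : Clock J S → ℝ) : Letter n J S → ℝ
  -- The idle letter keeps the total rate positive even when there are no particles or no events.
  | none => 1
  -- Each of the two coin values has the full rate; a particle reacts to exactly one of them.
  | some (_, γ, _) => α * ρ γ

/-- The total rate of the letters. -/
def totalWeight (n : ℕ) (α : ℝ) (ρ : Clock J S → ℝ) : ℝ := ∑ x : Letter n J S, weight α ρ x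

variable {α : ℝ} {ρ : Clock J S → ℝ}

lemma weight_nonneg (hα : 0 < α) (hρ : ∀ γ, 0 ≤ ρ γ) (x : Letter n J S) : 0 ≤ weight α ρ x := by
  rcases x with _ | ⟨i, γ, b⟩
  · exact zero_le_one
  · exact mul_nonneg hα.le (hρ γ)

lemma totalWeight_pos (hα : 0 < α) (hρ : ∀ γ, 0 ≤ ρ γ) : 0 < totalWeight n α ρ :=
  Finset.sum_pos' (fun x _ => weight_nonneg hα hρ x) ⟨none, Finset.mem_univ _, one_pos⟩

/-- The distribution of the letters. -/
def letters (n : ℕ) (hα : 0 < α) (hρ : ∀ γ, 0 ≤ ρ γ) : PMF (Letter n J S) :=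
  PMF.ofFintype (fun x => ENNReal.ofReal (weight α ρ x / totalWeight n α ρ)) (by
    rw [← ENNReal.ofReal_sum_of_nonneg fun x _ =>
      div_nonneg (weight_nonneg hα hρ x) (totalWeight_pos hα hρ).le, ← Finset.sum_div,
      ← totalWeight, div_self (totalWeight_pos hα hρ).ne', ENNReal.ofReal_one])

lemma letters_apply (hα : 0 < α) (hρ : ∀ γ, 0 ≤ ρ γ) (x : Letter n J S) :
    letters n hα hρ x = ENNReal.ofReal (weight α ρ x / totalWeight n α ρ) := rfl

lemma letters_ne_zero (hα : 0 < α) (hρ : ∀ γ, 0 ≤ ρ γ) {x : Letter n J S} (hx : 0 < weight α ρ x) :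
    letters n hα hρ x ≠ 0 := by
  rw [letters_apply]
  exact (ENNReal.ofReal_pos.2 (div_pos hx (totalWeight_pos hα hρ))).ne'

lemma isFair_letters (hα : 0 < α) (hρ : ∀ γ, 0 ≤ ρ γ) (hJ : ∀ j, 0 < ρ (Sum.inl j))
    (hS : ∀ σ σ' : S, Relation.ReflTransGen (fun a b => 0 < ρ (Sum.inr (a, b))) σ σ') :
    IsFair (letters n hα hρ) where
  none_ne_zero := letters_ne_zero hα hρ one_pos
  jump_ne_zero _ j _ := letters_ne_zero hα hρ (mul_pos hα (hJ j))
  jump_symm _ _ := rfl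
  irreducible _ σ σ' := (hS σ σ').lift id
    fun _ _ h => letters_ne_zero hα hρ (mul_pos hα h)

lemma mul_sum_letters (hα : 0 < α) (hρ : ∀ γ, 0 ≤ ρ γ) (h : Letter n J S → ℝ) (h0 : h none = 0) :
    totalWeight n α ρ * ∑ x, (letters n hα hρ x).toReal * h x =
      ∑ i, ∑ γ, α * ρ γ * (h (some (i, γ, true)) + h (some (i, γ, false))) := by
  have hT := (totalWeight_pos (n := n) hα hρ).ne'
  have h1 : ∀ x, totalWeight n α ρ * ((letters n hα hρ x).toReal * h x) = weight α ρ x * h x := by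
    intro x
    rw [letters_apply, ENNReal.toReal_ofReal
      (div_nonneg (weight_nonneg hα hρ x) (totalWeight_pos hα hρ).le)]
    field_simp
  rw [Finset.mul_sum, Finset.sum_congr rfl fun x _ => h1 x, Fintype.sum_option, h0, mul_zero,
    zero_add, Fintype.sum_prod_type]
  refine Finset.sum_congr rfl fun i _ => ?_
  rw [Fintype.sum_prod_type]
  refine Finset.sum_congr rfl fun γ _ => ?_
  rw [Fintype.sum_bool]
  simp only [weight]
  ring

end Fair

variable {d : ℕ} {J S : Type u} [Fintype J] [Fintype S] [DecidableEq J] [DecidableEq S]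

/-- The position of a particle with given numbers of jumps. -/
def project (w : J → Fin d → ℤ) (v : Lift J S) : Site d S := (∑ j, v.1 j • w j, v.2)

/-- The effect of an event on a particle. -/
def siteAct (lay : J → S) (w : J → Fin d → ℤ) : Clock J S → Site d S → Site d S
  | Sum.inl j, v => if lay j = v.2 then (v.1 + w j, v.2) else v
  | Sum.inr s, v => if s.1 = v.2 then (v.1, s.2) else v

lemma project_act (lay : J → S) (w : J → Fin d → ℤ) (γ : Clock J S) (v : Lift J S) :
    project w (act lay γ v) = siteAct lay w γ (project w v) := by
  rcases γ with j | s
  · by_cases h : lay j = v.2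
    · refine Prod.ext ?_ ?_ <;>
        simp [act, siteAct, project, h, add_smul, Finset.sum_add_distrib, Pi.single_apply]
    · simp [act, siteAct, project, h]
  · by_cases h : s.1 = v.2 <;> simp [act, siteAct, project, h]

/-- Walkers in layers couple if their jump vectors generate the lattice. -/
theorem indepParticlesCouple (lay : J → S) (w : J → Fin d → ℤ) (ρ : Clock J S → ℝ)
    (hρ : ∀ γ, 0 ≤ ρ γ) (hJ : ∀ j, 0 < ρ (Sum.inl j))
    (hS : ∀ σ σ' : S, Relation.ReflTransGen (fun a b => 0 < ρ (Sum.inr (a, b))) σ σ')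
    (hw : Nonempty S → Submodule.span ℤ (Set.range w) = ⊤) {α : ℝ} (hα : 0 < α)
    {p : Site d S → Site d S → ℝ} (hp : ∀ v (g : Site d S → ℝ), g v = 0 →
      ∑' v', p v v' * g v' = ∑ γ, ρ γ * g (siteAct lay w γ v)) :
    IndepParticlesCouple α p := by
  intro n
  have hsurj : ∀ v : Site d S, ∃ v', project w v' = v := by
    rintro ⟨x, σ⟩
    -- Generation of the lattice is assumed only for nonempty `S`; a site provides the layer.
    have hx : x ∈ Submodule.span ℤ (Set.range w) := by rw [hw ⟨σ⟩]; trivial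
    obtain ⟨m, hm⟩ := (Submodule.mem_span_range_iff_exists_fun ℤ).1 hx
    exact ⟨(m, σ), Prod.ext hm rfl⟩
  have : Fact (0 < totalWeight n α ρ) := ⟨totalWeight_pos hα hρ⟩
  refine hasSuccessfulCoupling_of_chain (totalWeight n α ρ) (letters n hα hρ)
    (step := pairsStep lay) (φ := fun z => Config.ofPositions fun i => project w (z i).1)
    (ψ := fun z => Config.ofPositions fun i => project w (z i).2) ?_ ?_ ?_ ?_
  · intro x x'
    obtain ⟨v, rfl⟩ := Config.exists_ofPositions x
    obtain ⟨v', rfl⟩ := Config.exists_ofPositions x'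
    choose m hm using fun i => hsurj (v i)
    choose m' hm' using fun i => hsurj (v' i)
    exact ⟨fun i => (m i, m' i), by simp [hm], by simp [hm']⟩
  · intro z f
    have hup : ∀ (i : Fin n) (q : Lift J S × Lift J S),
        (fun k => project w (Function.update z i q k).1) =
          Function.update (fun k => project w (z k).1) i (project w q.1) := by
      intro i q; funext k
      by_cases hk : k = i
      · subst hk; simp
      · simp [hk]
    rw [mul_sum_letters hα hρ _ (sub_self _), Config.indepGenerator_ofPositions hp]
    refine Finset.sum_congr rfl fun i _ => Finset.sum_congr rfl fun γ _ => ?_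
    simp [pairsStep, hup, pairStep, project_act]
  · intro z f
    have hup : ∀ (i : Fin n) (q : Lift J S × Lift J S),
        (fun k => project w (Function.update z i q k).2) =
          Function.update (fun k => project w (z k).2) i (project w q.2) := by
      intro i q; funext k
      by_cases hk : k = i
      · subst hk; simp
      · simp [hk]
    rw [mul_sum_letters hα hρ _ (sub_self _), Config.indepGenerator_ofPositions hp]
    refine Finset.sum_congr rfl fun i _ => Finset.sum_congr rfl fun γ _ => ?_
    -- Same coin or opposite coin: either way exactly one coin value moves the second particle, so
    -- its marginal does not see the coupling.
    cases h : uncoupled γ (z i).1 (z i).2 <;>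
      simp [pairsStep, hup, pairStep, project_act, h]
  · intro _ _ z
    filter_upwards [ae_pairs_eventually_eq lay (totalWeight n α ρ)
      (isFair_letters hα hρ hJ hS) z] with ω ⟨K, hK⟩
    exact ⟨K, fun k hk => by simp only [hK k hk]⟩

end LayeredWalk

/-! ### Decomposing the rates into jumps -/

namespace LayeredWalk

variable {d : ℕ} {S : Type u}

lemma rate_eq_sum_of_isSimpleSymmetric {π : (Fin d → ℤ) → ℝ} (hπ : IsSimpleSymmetric π)
    (x : Fin d → ℤ) : π x = ∑ k : Fin d, ∑ b : Bool,
      if x = (if b then Pi.single k 1 else -Pi.single k 1) then π (Pi.single k 1) else 0 := by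
  have h1 : ∀ (k : Fin d) (b : Bool),
      (if x = (if b then Pi.single k 1 else -Pi.single k 1) then π (Pi.single k 1) else 0) =
      if x = (if b then Pi.single k 1 else -Pi.single k 1) then π x else 0 := by
    intro k b
    split_ifs with h2 h3 h3
    · rw [h3]
    · rfl
    · rw [h3, hπ.symm]
    · rfl
  simp only [h1]
  by_cases hx : ∃ k, x = Pi.single k 1 ∨ x = -Pi.single k 1
  · obtain ⟨k, hk⟩ := hx
    have hsgn : ∃ b : Bool, x = if b then Pi.single k 1 else -Pi.single k 1 :=
      hk.elim (fun h => ⟨true, by simpa using h⟩) fun h => ⟨false, by simpa using h⟩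
    obtain ⟨b, hb⟩ := hsgn
    have huniq : ∀ (k' : Fin d) (b' : Bool),
        x = (if b' then Pi.single k' 1 else -Pi.single k' 1) → k' = k ∧ b' = b := by
      intro k' b' h
      have hne : x k ≠ 0 := by rw [hb]; cases b <;> simp
      have hk' : k' = k := by
        by_contra hkk
        apply hne
        rw [h]
        cases b' <;> simp [Ne.symm hkk]
      subst hk'
      refine ⟨rfl, ?_⟩
      have h2 := congrFun (hb.symm.trans h) k'
      cases b <;> cases b' <;> simp at h2 ⊢
    rw [Finset.sum_eq_single k, Finset.sum_eq_single b, if_pos hb]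
    · intro b' _ hne
      exact if_neg fun h => hne (huniq k b' h).2
    · simp
    · intro k' _ hne
      exact Finset.sum_eq_zero fun b' _ => if_neg fun h => hne (huniq k' b' h).1
    · simp
  · push Not at hx
    rw [hπ.nearest x hx]
    simp

/-- The kinds of jumps of a run-and-tumble particle: a step of the random walk in a layer, or a step
with the velocity of the layer. -/
abbrev Jump (d : ℕ) (S : Type u) : Type u := (S × Fin d × Bool) ⊕ S

/-- The layer of a jump. -/
def jumpLayer : Jump d S → S
  | Sum.inl j => j.1
  | Sum.inr σ => σ

/-- The vector of a jump. -/
def jumpVector (vel : S → Fin d → ℤ) : Jump d S → Fin d → ℤ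
  | Sum.inl j => if j.2.2 then Pi.single j.2.1 1 else -Pi.single j.2.1 1
  | Sum.inr σ => -vel σ

/-- The rate of a jump. -/
def jumpRate (κ lam : ℝ) (π : S → (Fin d → ℤ) → ℝ) : Jump d S → ℝ
  | Sum.inl j => κ * π j.1 (Pi.single j.2.1 1)
  | Sum.inr _ => lam

lemma jumpRate_nonneg {κ lam : ℝ} (hκ : 0 ≤ κ) (hlam : 0 ≤ lam) {π : S → (Fin d → ℤ) → ℝ}
    (hπ : ∀ σ, IsSimpleSymmetric (π σ)) (j : Jump d S) : 0 ≤ jumpRate κ lam π j := by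
  rcases j with j | σ
  · exact mul_nonneg hκ ((hπ _).pos _).le
  · exact hlam

variable [Fintype S] [DecidableEq S]

/-- Events belonging to another layer leave `v` fixed and contribute nothing because `g v = 0`; so
the sum may run over all layers, with rates that do not depend on the state. -/
lemma hasSum_dualRtpRate (κ lam : ℝ) {π : S → (Fin d → ℤ) → ℝ} (hπ : ∀ σ, IsSimpleSymmetric (π σ))
    (vel : S → Fin d → ℤ) (c : S → S → ℝ) (v : Site d S) (g : Site d S → ℝ) (hg : g v = 0) :
    HasSum (fun v' => dualRtpRate κ lam π vel c v v' * g v')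
      (∑ j, jumpRate κ lam π j *
          g (if jumpLayer j = v.2 then (v.1 + jumpVector vel j, v.2) else v) +
        ∑ s : S × S, c s.1 s.2 * g (if s.1 = v.2 then (v.1, s.2) else v)) := by
  obtain ⟨x, σ⟩ := v
  have hwalk : HasSum (fun v' : Site d S => ∑ k : Fin d, ∑ b : Bool,
      if v' = (x + (if b then Pi.single k 1 else -Pi.single k 1), σ) then
        κ * π σ (Pi.single k 1) * g (x + (if b then Pi.single k 1 else -Pi.single k 1), σ) else 0)
      (∑ k : Fin d, ∑ b : Bool,
        κ * π σ (Pi.single k 1) * g (x + (if b then Pi.single k 1 else -Pi.single k 1), σ)) :=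
    hasSum_sum fun k _ => hasSum_sum fun b _ => hasSum_ite_eq _ _
  have hvel := hasSum_ite_eq ((x - vel σ, σ) : Site d S) (lam * g (x - vel σ, σ))
  have hsw : HasSum (fun v' : Site d S => ∑ σ' : S,
      if v' = (x, σ') then c σ σ' * g (x, σ') else 0) (∑ σ' : S, c σ σ' * g (x, σ')) :=
    hasSum_sum fun σ' _ => hasSum_ite_eq _ _
  convert! (hwalk.add hvel).add hsw using 1
  · funext ⟨y, σ'⟩
    simp only [dualRtpRate, add_mul]
    congr 2
    · by_cases hσ : σ = σ'
      · subst hσ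
        rw [if_pos rfl, rate_eq_sum_of_isSimpleSymmetric (hπ σ), Finset.mul_sum, Finset.sum_mul]
        refine Finset.sum_congr rfl fun k _ => ?_
        rw [Finset.mul_sum, Finset.sum_mul]
        refine Finset.sum_congr rfl fun b _ => ?_
        by_cases h : y - x = if b then Pi.single k 1 else -Pi.single k 1
        · rw [if_pos h, if_pos (by rw [← h, add_sub_cancel]), ← h, add_sub_cancel]
        · rw [if_neg h, if_neg fun h' => h (by rw [(Prod.mk.inj h').1, add_sub_cancel_left]),
            mul_zero, zero_mul]
      · simp [hσ, Ne.symm hσ]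
    · by_cases h : σ = σ' ∧ y = x - vel σ
      · obtain ⟨rfl, rfl⟩ := h
        simp
      · rw [if_neg h, if_neg fun h' => h ⟨(Prod.mk.inj h').2.symm, (Prod.mk.inj h').1⟩, zero_mul]
    · by_cases h : x = y
      · subst h
        simp
      · simp [h, Ne.symm h]
  · congr 1
    · rw [Fintype.sum_sum_type]
      congr 1
      · rw [Fintype.sum_prod_type, Finset.sum_eq_single σ, Fintype.sum_prod_type]
        · simp only [jumpRate, jumpLayer, jumpVector, if_true]
        · intro τ _ hτ
          refine Finset.sum_eq_zero fun j _ => ?_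
          simp [jumpLayer, hτ, hg]
        · simp
      · rw [Finset.sum_eq_single σ]
        · simp [jumpRate, jumpLayer, jumpVector, sub_eq_add_neg]
        · intro τ _ hτ
          simp [jumpLayer, hτ, hg]
        · simp
    · rw [Fintype.sum_prod_type, Finset.sum_eq_single σ]
      · simp
      · intro τ _ hτ
        simp [hτ, hg]
      · simp

/-- The kinds of jumps are restricted to those of positive rate, since a gap of a kind that never
rings would never close. This treats `κ = 0` and `lam = 0` together with the generic case; only the
surviving vectors must generate the lattice. -/
theorem indepParticlesCouple_dualRtpRate {κ lam : ℝ} (hκ : 0 ≤ κ) (hlam : 0 ≤ lam)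
    {π : S → (Fin d → ℤ) → ℝ} (hπ : ∀ σ, IsSimpleSymmetric (π σ)) {c : S → S → ℝ}
    (hc : IsSymmIrreducible c) (vel : S → Fin d → ℤ) {α : ℝ} (hα : 0 < α)
    (hspan : Nonempty S → Submodule.span ℤ
      (Set.range fun j : {j : Jump d S // 0 < jumpRate κ lam π j} => jumpVector vel j.1) = ⊤) :
    IndepParticlesCouple α (dualRtpRate κ lam π vel c) := by
  classical
  refine indepParticlesCouple (J := {j : Jump d S // 0 < jumpRate κ lam π j})
    (fun j => jumpLayer j.1) (fun j => jumpVector vel j.1)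
    (Sum.elim (fun j => jumpRate κ lam π j.1) fun s => c s.1 s.2) ?_ (fun j => j.2)
    hc.irreducible hspan hα ?_
  · rintro (j | s)
    · exact j.2.le
    · exact hc.nonneg _ _
  · intro v g hg
    rw [(hasSum_dualRtpRate κ lam hπ vel c v g hg).tsum_eq]
    conv_rhs => rw [Fintype.sum_sum_type]
    congr 1
    have hz : ∀ j ∈ (Finset.univ : Finset (Jump d S)), jumpRate κ lam π j *
        g (if jumpLayer j = v.2 then (v.1 + jumpVector vel j, v.2) else v) ≠ 0 →
          0 < jumpRate κ lam π j := fun j _ h =>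
      (jumpRate_nonneg hκ hlam hπ j).lt_of_ne' (left_ne_zero_of_mul h)
    rw [← Finset.sum_filter_of_ne hz, ← Finset.sum_subtype_eq_sum_filter, Finset.subtype_univ]
    rfl

lemma indepParticlesCouple_dualRtpRate_of_pos {κ lam : ℝ} (hκ : 0 < κ) (hlam : 0 ≤ lam)
    {π : S → (Fin d → ℤ) → ℝ} (hπ : ∀ σ, IsSimpleSymmetric (π σ)) {c : S → S → ℝ}
    (hc : IsSymmIrreducible c) (vel : S → Fin d → ℤ) {α : ℝ} (hα : 0 < α) :
    IndepParticlesCouple α (dualRtpRate κ lam π vel c) := by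
  refine indepParticlesCouple_dualRtpRate hκ.le hlam hπ hc vel hα fun ⟨σ⟩ => ?_
  rw [eq_top_iff, ← (Pi.basisFun ℤ (Fin d)).span_eq]
  refine Submodule.span_mono ?_
  rintro _ ⟨k, rfl⟩
  refine ⟨⟨Sum.inl (σ, k, true), mul_pos hκ ((hπ σ).pos k)⟩, ?_⟩
  simp [jumpVector]

lemma walkRate_eq_dualRtpRate (π : S → (Fin d → ℤ) → ℝ) (c : S → S → ℝ) :
    walkRate π c = dualRtpRate 1 0 π 0 c := by
  funext a b
  simp [walkRate, dualRtpRate]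

end LayeredWalk

end

theorem mainTheorem5 (d : ℕ) {S : Type u} [Finite S] [DecidableEq S]
    (π : S → (Fin d → ℤ) → ℝ) (hπ : ∀ σ, IsSimpleSymmetric (π σ))
    (c : S → S → ℝ) (hc : IsSymmIrreducible c) (α : ℝ) (hα : 0 < α) :
    -- multi-layer symmetric independent random walkers
    IndepParticlesCouple α (walkRate π c) ∧
    -- dual run-and-tumble particles with random walk jumps
    (∀ (vel : S → (Fin d → ℤ)) (κ lam : ℝ), 0 < κ → 0 ≤ lam →
      IndepParticlesCouple α (dualRtpRate κ lam π vel c)) ∧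
    -- dual run-and-tumble particles without random walk jumps
    (∀ (vel : S → (Fin d → ℤ)) (lam : ℝ), 0 < lam →
      Submodule.span ℤ (Set.range vel) = ⊤ →
      IndepParticlesCouple α (dualRtpRate 0 lam π vel c)) := by
  have := Fintype.ofFinite S
  refine ⟨?_, fun vel κ lam hκ hlam =>
    LayeredWalk.indepParticlesCouple_dualRtpRate_of_pos hκ hlam hπ hc vel hα, fun vel lam hlam hspan => ?_⟩
  · rw [LayeredWalk.walkRate_eq_dualRtpRate]
    exact LayeredWalk.indepParticlesCouple_dualRtpRate_of_pos one_pos le_rfl hπ hc 0 hα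
  · refine LayeredWalk.indepParticlesCouple_dualRtpRate le_rfl hlam.le hπ hc vel hα fun _ => ?_
    rw [eq_top_iff, ← hspan, Submodule.span_le]
    rintro _ ⟨σ, rfl⟩
    -- The dual particle jumps by `-vel σ`, and the span is closed under negation.
    rw [SetLike.mem_coe, ← neg_neg (vel σ)]
    exact Submodule.neg_mem _ (Submodule.subset_span ⟨⟨Sum.inr σ, hlam⟩, rfl⟩)
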